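/- Let $a>0$, $M>0$, and let $\Omega=\{u=(\rho,q)\in\mathbb R^2:\rho>0\}$ be the phase space of the isothermal gas system $\rho_t+q_x=0$, $q_t+(q^2/\rho+a^2\rho)_x=0$, with pressure $p(\rho)=a^2\rho$. For $u\in\Omega$ put $v=q/\rho$, $\lambda_1(u)=v-a$, $\lambda_2(u)=v+a$, $w(u)=\frac{q}{a\rho}+\log\rho$, $z(u)=\frac{q}{a\rho}-\log\rho$. *Lax curves and the Lax solver.* For $u_*\in\Omega$ and $\rho>0$ let $$\mathcal{FL}_1(\rho,u_*)=\begin{cases}\rho\left[v_*-a\log(\rho/\rho_*)\right]&\rho\le\rho_*,\\ \rho\left[v_*-a\left(\sqrt{\rho/\rho_*}-\sqrt{\rho_*/\rho}\right)\right]&\rho>\rho_*,\end{cases}\qquad \mathcal{BL}_2(\rho,u_*)=\begin{cases}\rho\left[v_*+a\log(\rho/\rho_*)\right]&\rho\le\rho_*,\\ \rho\left[v_*+a\left(\sqrt{\rho/\rho_*}-\sqrt{\rho_*/\rho}\right)\right]&\rho>\rho_*.\end{cases}$$ Let $\tilde u=\tilde u(u_\ell,u_r)$ be the unique common point of the graphs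 of $\mathcal{FL}_1(\cdot,u_\ell)$ and $\mathcal{BL}_2(\cdot,u_r)$; let $\hat u(u_*)$, resp. $\check u(u_*)$, be the intersection of the graph of $\mathcal{FL}_1(\cdot,u_*)$, resp. $\mathcal{BL}_2(\cdot,u_*)$, with the line $q=0$ that has the largest density; write $\hat u_\ell=\hat u(u_\ell)$, $\hat p_\ell=p(\hat\rho_\ell)$, $\check u_r=\check u(u_r)$, $\check p_r=p(\check\rho_r)$. The Lax Riemann solver $\mathcal{RS}_{\rm p}:\Omega^2\to BV(\mathbb R;\Omega)$ maps $(u_\ell,u_r)$ to the right-continuous self-similar profile $u_{\rm p}(\xi)$, $\xi=x/t$, made of a wave of the first family from $u_\ell$ to $\tilde u$ (a shock if $\tilde\rho>\rho_\ell$, a possibly null rarefaction otherwise) followed by a wave of the second family from $\tilde u$ to $u_r$ (a shock if $\rho_r<\tilde\rho$, a possibly null rarefaction otherwise). A shock between $u$ and $u'$ has speed $(q-q')/(\rho-\rho')$; an $i$-rarefaction from $u$ to $u'$ occupies $\lambda_i(u)\le\xi\le\lambda_i(u')$, with $\lambda_i=\xi$ at $\xi$ and with $w$ (if $i=1$) or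 $z$ (if $i=2$) constant. Put $u_{\rm p}^\pm=u_{\rm p}(0^\pm)$. *The valve.* Let $\mathsf A=\{(u_\ell,u_r)\in\Omega^2:|\check p_r-\hat p_\ell|\le M\}$ and $\mathsf O=\Omega^2\setminus\mathsf A$. The two-way electronic pressure valve is the solver $u_{\rm v}=\mathcal{RS}_{\rm v}[u_\ell,u_r]$ on $\mathsf D=\Omega^2$ given by $\mathcal{RS}_{\rm v}[u_\ell,u_r]=\mathcal{RS}_{\rm p}[u_\ell,u_r]$ on $\mathsf O$ and, on $\mathsf A$, by $\mathcal{RS}_{\rm v}[u_\ell,u_r](\xi)=\mathcal{RS}_{\rm p}[u_\ell,\hat u_\ell](\xi)$ for $\xi<0$ and $=\mathcal{RS}_{\rm p}[\check u_r,u_r](\xi)$ for $\xi\ge0$. Let $\mathsf A_{\mathsf N}=\{(u_\ell,u_r)\in\mathsf A:u_{\rm v}\equiv u_{\rm p}\}$, $\mathsf A_{\mathsf I}=\mathsf A\setminus\mathsf A_{\mathsf N}$, $\mathsf A_{\mathsf I}^{\complement}=\Omega^2\setminus\mathsf A_{\mathsf I}$. *Properties.* Let $\mathcal{RS}$ be a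 solver on $\mathsf D$ and let $u=\mathcal{RS}[u_\ell,u_r]$ for $(u_\ell,u_r)\in\mathsf D$. The coherence domain $\mathsf{CH}$ is the set of $(u_\ell,u_r)\in\mathsf D$ such that $(u(0^-),u(0^+))\in\mathsf D$ and $\mathcal{RS}[u(0^-),u(0^+)]$ equals $u(0^-)$ for $\xi<0$ and $u(0^+)$ for $\xi\ge0$. The consistence domain $\mathsf{CN}$ is the set of $(u_\ell,u_r)\in\mathsf D$ such that for every $\xi_o\in\mathbb R$: $(u_\ell,u(\xi_o)),(u(\xi_o),u_r)\in\mathsf D$; $\mathcal{RS}[u_\ell,u(\xi_o)]$ equals $u(\xi)$ for $\xi<\xi_o$ and $u(\xi_o)$ for $\xi\ge\xi_o$; $\mathcal{RS}[u(\xi_o),u_r]$ equals $u(\xi_o)$ for $\xi<\xi_o$ and $u(\xi)$ for $\xi\ge\xi_o$; and $u(\xi)$ equals $\mathcal{RS}[u_\ell,u(\xi_o)](\xi)$ for $\xi<\xi_o$ and $\mathcal{RS}[u(\xi_o),u_r](\xi)$ for $\xi\ge\xi_o$. The $L^1_{loc}$-continuity domain $\mathsf L$ is the set of $(u_\ell,u_r)\in\mathsf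 D$ such that $\int_{\xi_1}^{\xi_2}\|\mathcal{RS}[u_\ell',u_r'](\xi)-\mathcal{RS}[u_\ell,u_r](\xi)\|\,d\xi\to0$ as $(u_\ell',u_r')\to(u_\ell,u_r)$ in $\mathsf D$, for all $\xi_1,\xi_2\in\mathbb R$. A set $\mathcal I\subseteq\Omega$ is an invariant domain if $\mathcal I^2\subseteq\mathsf D$ and $\mathcal{RS}[u_\ell,u_r](\xi)\in\mathcal I$ for all $u_\ell,u_r\in\mathcal I$ and $\xi\in\mathbb R$. **Theorem.** For $\mathcal{RS}_{\rm v}$ the following hold. (I) $\mathsf{CH}=\mathsf A\cup\mathsf O_{\mathsf O}$, where $\mathsf O_{\mathsf O}=\{(u_\ell,u_r)\in\mathsf O:(u_{\rm p}^-,u_{\rm p}^+)\in\mathsf O\}$. (II) $\mathsf{CN}=\mathsf{CN}_1\cup\mathsf{CN}_2=\mathsf{CN}_{\mathsf O}\cup\mathsf{CN}_{\mathsf A}$, where $$\begin{aligned} \mathsf{CN}_1&=\{(u_\ell,u_r)\in\mathsf A_{\mathsf I}:(u_\ell,u_{\rm v}(\xi_o^-)),(u_{\rm v}(\xi_o^+),u_r)\in\mathsf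 A_{\mathsf I}^{\complement}\text{ for all }\xi_o^-<0\le\xi_o^+\},\\ \mathsf{CN}_2&=\{(u_\ell,u_r)\in\mathsf A_{\mathsf I}^{\complement}:(u_\ell,u_{\rm v}(\xi_o)),(u_{\rm v}(\xi_o),u_r)\in\mathsf A_{\mathsf I}^{\complement}\text{ for all }\xi_o\in\mathbb R\},\\ \mathsf{CN}_{\mathsf O}&=\{(u_\ell,u_r)\in\mathsf O:(u_\ell,u_\ell),(u_r,u_r),(u_\ell,\tilde u),(\tilde u,u_r)\in\mathsf A_{\mathsf I}^{\complement}\text{ and }q_{\rm p}\ne0\text{ along any rarefaction of }u_{\rm p}\text{, end states included}\},\\ \mathsf{CN}_{\mathsf A}&=\{(u_\ell,u_r)\in\mathsf A:q_\ell\ge0\ge q_r,\ (u_\ell,u_\ell),(u_r,u_r)\in\mathsf A_{\mathsf I}^{\complement}\}. \end{aligned}$$ (III) $\mathsf L=\{(u_\ell,u_r)\in\Omega^2:|\check p_r-\hat p_\ell|\ne M\}$. (IV) For every $u_0=(\rho_0,q_0)\in\Omega$ with $q_0=0$, the set $\mathcal I_{u_0}=\{u\in\Omega:z(u)\ge z(u_0),\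 w(u)\le w(u_0)\}$ is an invariant domain of $\mathcal{RS}_{\rm v}$. -/

import Mathlib

open Set Filter Topology MeasureTheory

namespace GasValve

noncomputable section

/-- A state `u = (ρ, q)`: density `u.1`, linear momentum `u.2`. -/
abbrev State := ℝ × ℝ

/-- The phase space `Ω = {(ρ, q) : ρ > 0}`. -/
def Omega : Set State := {u | 0 < u.1}

/-- The velocity `v = q / ρ`. -/
def vel (u : State) : ℝ := u.2 / u.1

/-- The isothermal pressure law `p(ρ) = a² ρ`. -/
def pressure (a ρ : ℝ) : ℝ := a ^ 2 * ρ

/-- First eigenvalue. -/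
def lam1 (a : ℝ) (u : State) : ℝ := vel u - a

/-- Second eigenvalue. -/
def lam2 (a : ℝ) (u : State) : ℝ := vel u + a

/-- Riemann invariant `w`. -/
def invW (a : ℝ) (u : State) : ℝ := u.2 / (a * u.1) + Real.log u.1

/-- Riemann invariant `z`. -/
def invZ (a : ℝ) (u : State) : ℝ := u.2 / (a * u.1) - Real.log u.1

/-! ### Lax curves -/

/-- Shock curve of the first family through `u`. -/
def S1 (a ρ : ℝ) (u : State) : ℝ :=
  ρ * (u.2 / u.1 - a * (√(ρ / u.1) - √(u.1 / ρ)))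

/-- Rarefaction curve of the first family through `u`. -/
def R1 (a ρ : ℝ) (u : State) : ℝ :=
  ρ * (u.2 / u.1 - a * Real.log (ρ / u.1))

/-- Shock curve of the second family through `u`. -/
def S2 (a ρ : ℝ) (u : State) : ℝ :=
  ρ * (u.2 / u.1 + a * (√(ρ / u.1) - √(u.1 / ρ)))

/-- Rarefaction curve of the second family through `u`. -/
def R2 (a ρ : ℝ) (u : State) : ℝ :=
  ρ * (u.2 / u.1 + a * Real.log (ρ / u.1))

/-- Forward Lax curve of the first family through `u`. -/
def FL1 (a ρ : ℝ) (u : State) : ℝ := if ρ ≤ u.1 then R1 a ρ u else S1 a ρ u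

/-- Backward Lax curve of the second family through `u`. -/
def BL2 (a ρ : ℝ) (u : State) : ℝ := if ρ ≤ u.1 then R2 a ρ u else S2 a ρ u

/-- Density of the intersection of `FL1` through `ul` and `BL2` through `ur`
(see `existsUnique_tilde`). -/
def tildeRho (a : ℝ) (ul ur : State) : ℝ :=
  Classical.epsilon fun ρ => 0 < ρ ∧ FL1 a ρ ul = BL2 a ρ ur

/-- The state `ũ(ul, ur)`, the unique element of `FL1^{ul} ∩ BL2^{ur}`. -/
def tilde (a : ℝ) (ul ur : State) : State :=
  (tildeRho a ul ur, FL1 a (tildeRho a ul ur) ul)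

/-- The largest density at which `FL1` through `u` meets the line `q = qm`. -/
def hatRho (a qm : ℝ) (u : State) : ℝ :=
  Classical.epsilon fun ρ => IsGreatest {r | 0 < r ∧ FL1 a r u = qm} ρ

/-- The state `û(qm, u)`. -/
def hat (a qm : ℝ) (u : State) : State := (hatRho a qm u, qm)

/-- The largest density at which `BL2` through `u` meets the line `q = qm`. -/
def checkRho (a qm : ℝ) (u : State) : ℝ :=
  Classical.epsilon fun ρ => IsGreatest {r | 0 < r ∧ BL2 a r u = qm} ρ

/-- The state `ǔ(qm, u)`. -/
def check (a qm : ℝ) (u : State) : State := (checkRho a qm u, qm)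

/-! ### Well-posedness of the choices above (for `qm = 0` in the case of `û` and `ǔ`) -/

/-- The function `t ↦ t` for `t ≤ 0`, `t ↦ 2 sinh (t / 2)` for `t > 0`. -/
def prof (t : ℝ) : ℝ := if t ≤ 0 then t else 2 * Real.sinh (t / 2)

theorem le_prof (t : ℝ) : t ≤ prof t := by
  unfold prof
  split_ifs with h
  · exact le_rfl
  · have : t / 2 ≤ Real.sinh (t / 2) := Real.self_le_sinh_iff.2 (by linarith)
    linarith

theorem prof_strictMono : StrictMono prof := by
  intro s t hst
  unfold prof
  have hm : Real.sinh (s / 2) < Real.sinh (t / 2) := Real.sinh_lt_sinh.2 (by linarith)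
  split_ifs with h1 h2 h2
  · exact hst
  · have : 0 < Real.sinh (t / 2) := Real.sinh_pos_iff.2 (by linarith)
    linarith
  · linarith
  · linarith

theorem prof_continuous : Continuous prof := by
  unfold prof
  refine Continuous.if_le continuous_id (by fun_prop) continuous_id continuous_const ?_
  intro x hx
  simp [hx]

theorem prof_atTop : Tendsto prof atTop atTop := tendsto_atTop_mono le_prof tendsto_id

theorem prof_atBot : Tendsto prof atBot atBot := by
  refine tendsto_id.congr' ?_
  filter_upwards [eventually_le_atBot (0 : ℝ)] with t ht
  simp [prof, ht]

theorem sqrt_diff (t m : ℝ) :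
    √(Real.exp t / Real.exp m) - √(Real.exp m / Real.exp t) = 2 * Real.sinh ((t - m) / 2) := by
  rw [← Real.exp_sub, ← Real.exp_sub, Real.sqrt_eq_rpow, ← Real.exp_mul,
    Real.sqrt_eq_rpow, ← Real.exp_mul, Real.sinh_eq]
  ring_nf

theorem FL1_exp (a t : ℝ) {u : State} (hu : u ∈ Omega) :
    FL1 a (Real.exp t) u = Real.exp t * (vel u - a * prof (t - Real.log u.1)) := by
  have hu' : 0 < u.1 := hu
  obtain ⟨m, hm⟩ : ∃ m, u.1 = Real.exp m := ⟨Real.log u.1, (Real.exp_log hu').symm⟩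
  simp only [FL1, R1, S1, vel, prof, hm, Real.exp_le_exp, Real.log_exp, sqrt_diff, sub_nonpos]
  split_ifs
  · rw [← Real.exp_sub, Real.log_exp]
  · rfl

theorem BL2_exp (a t : ℝ) {u : State} (hu : u ∈ Omega) :
    BL2 a (Real.exp t) u = Real.exp t * (vel u + a * prof (t - Real.log u.1)) := by
  have hu' : 0 < u.1 := hu
  obtain ⟨m, hm⟩ : ∃ m, u.1 = Real.exp m := ⟨Real.log u.1, (Real.exp_log hu').symm⟩
  simp only [BL2, R2, S2, vel, prof, hm, Real.exp_le_exp, Real.log_exp, sqrt_diff, sub_nonpos]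
  split_ifs
  · rw [← Real.exp_sub, Real.log_exp]
  · rfl

theorem shift_prof_surj (m c : ℝ) : ∃ t, prof (t - m) = c := by
  obtain ⟨s, hs⟩ := prof_continuous.surjective prof_atTop prof_atBot c
  exact ⟨s + m, by simpa using hs⟩

/-- The curves `FL1^{ul}` and `BL2^{ur}` meet in exactly one point. -/
theorem existsUnique_tilde {a : ℝ} (ha : 0 < a) {ul ur : State}
    (hl : ul ∈ Omega) (hr : ur ∈ Omega) :
    ∃! ρ, 0 < ρ ∧ FL1 a ρ ul = BL2 a ρ ur := by
  set F : ℝ → ℝ := fun t => prof (t - Real.log ul.1) + prof (t - Real.log ur.1) with hF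
  have key : ∀ t, FL1 a (Real.exp t) ul = BL2 a (Real.exp t) ur ↔
      F t = (vel ul - vel ur) / a := by
    intro t
    rw [FL1_exp a t hl, BL2_exp a t hr, mul_right_inj' (Real.exp_pos t).ne', eq_div_iff ha.ne']
    constructor <;> intro h <;> simp only [hF] at * <;> linarith
  have hmono : StrictMono F := fun s t h =>
    add_lt_add (prof_strictMono (by linarith)) (prof_strictMono (by linarith))
  have hcont : Continuous F :=
    (prof_continuous.comp (by fun_prop)).add (prof_continuous.comp (by fun_prop))
  have htop : Tendsto F atTop atTop :=
    (prof_atTop.comp (tendsto_atTop_add_const_right _ _ tendsto_id)).atTop_add_atTop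
      (prof_atTop.comp (tendsto_atTop_add_const_right _ _ tendsto_id))
  have hbot : Tendsto F atBot atBot :=
    (prof_atBot.comp (tendsto_atBot_add_const_right _ _ tendsto_id)).atBot_add_atBot
      (prof_atBot.comp (tendsto_atBot_add_const_right _ _ tendsto_id))
  obtain ⟨t, ht⟩ := hcont.surjective htop hbot ((vel ul - vel ur) / a)
  refine ⟨Real.exp t, ⟨Real.exp_pos t, (key t).2 ht⟩, ?_⟩
  rintro ρ ⟨hρ, h⟩
  rw [← Real.exp_log hρ] at h ⊢
  rw [hmono.injective (((key _).1 h).trans ht.symm)]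

theorem exists_hat {a : ℝ} (ha : 0 < a) {u : State} (hu : u ∈ Omega) :
    ∃ ρ, IsGreatest {r | 0 < r ∧ FL1 a r u = 0} ρ := by
  obtain ⟨t, ht⟩ := shift_prof_surj (Real.log u.1) (vel u / a)
  refine ⟨Real.exp t, ⟨Real.exp_pos t, ?_⟩, ?_⟩
  · rw [FL1_exp a t hu, ht]
    field_simp
    ring
  · rintro ρ ⟨hρ, h⟩
    rw [← Real.exp_log hρ] at h ⊢
    rw [FL1_exp a _ hu, mul_eq_zero, or_iff_right (Real.exp_pos _).ne'] at h
    have h2 : prof (Real.log ρ - Real.log u.1) = vel u / a := by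
      rw [eq_div_iff ha.ne']; linarith
    have := prof_strictMono.injective (h2.trans ht.symm)
    rw [sub_left_inj.1 this]

theorem exists_check {a : ℝ} (ha : 0 < a) {u : State} (hu : u ∈ Omega) :
    ∃ ρ, IsGreatest {r | 0 < r ∧ BL2 a r u = 0} ρ := by
  obtain ⟨t, ht⟩ := shift_prof_surj (Real.log u.1) (-vel u / a)
  refine ⟨Real.exp t, ⟨Real.exp_pos t, ?_⟩, ?_⟩
  · rw [BL2_exp a t hu, ht]
    field_simp
    ring
  · rintro ρ ⟨hρ, h⟩
    rw [← Real.exp_log hρ] at h ⊢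
    rw [BL2_exp a _ hu, mul_eq_zero, or_iff_right (Real.exp_pos _).ne'] at h
    have h2 : prof (Real.log ρ - Real.log u.1) = -vel u / a := by
      rw [eq_div_iff ha.ne']; linarith
    have := prof_strictMono.injective (h2.trans ht.symm)
    rw [sub_left_inj.1 this]

/-! ### The Lax Riemann solver -/

/-- Speed of a shock between two states (with different densities). -/
def shockSpeed (u u' : State) : ℝ := (u.2 - u'.2) / (u.1 - u'.1)

/-- Right-continuous profile of the wave of the first family from `u` to a state `u'` of
`FL1^u`: a shock if `ρ < ρ'`, a (possibly null) rarefaction otherwise. Inside the rarefaction the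
value at `ξ` is the state on `R1^u` whose first eigenvalue is `ξ`. -/
def wave1 (a : ℝ) (u u' : State) (ξ : ℝ) : State :=
  if u.1 < u'.1 then
    if ξ < shockSpeed u u' then u else u'
  else if ξ < lam1 a u then u
  else if ξ < lam1 a u' then
    (u.1 * Real.exp ((lam1 a u - ξ) / a),
      u.1 * Real.exp ((lam1 a u - ξ) / a) * (ξ + a))
  else u'

/-- Right-continuous profile of the wave of the second family from a state `u` of `BL2^{u'}` to
`u'`: a shock if `ρ' < ρ`, a (possibly null) rarefaction otherwise. Inside the rarefaction the
value at `ξ` is the state on `R2^u` whose second eigenvalue is `ξ`. -/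
def wave2 (a : ℝ) (u u' : State) (ξ : ℝ) : State :=
  if u'.1 < u.1 then
    if ξ < shockSpeed u u' then u else u'
  else if ξ < lam2 a u then u
  else if ξ < lam2 a u' then
    (u.1 * Real.exp ((ξ - lam2 a u) / a),
      u.1 * Real.exp ((ξ - lam2 a u) / a) * (ξ - a))
  else u'

/-- The Lax Riemann solver: a wave of the first family from `ul` to `ũ` followed by a wave of the
second family from `ũ` to `ur`. All speeds of the first wave are smaller, and all speeds of
the second wave are larger, than the velocity of `ũ`. -/
def RSp (a : ℝ) (ul ur : State) (ξ : ℝ) : State :=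
  if ξ < vel (tilde a ul ur) then wave1 a ul (tilde a ul ur) ξ
  else wave2 a (tilde a ul ur) ur ξ

/-! ### Properties of a coupling Riemann solver `RS` with domain `D` -/

/-- Coherence domain; the interface is at `ξ = 0`. -/
def coherenceDomain (D : Set (State × State)) (RS : State → State → ℝ → State) :
    Set (State × State) :=
  {d ∈ D |
    (Function.leftLim (RS d.1 d.2) 0, Function.rightLim (RS d.1 d.2) 0) ∈ D ∧
    ∀ ξ, RS (Function.leftLim (RS d.1 d.2) 0) (Function.rightLim (RS d.1 d.2) 0) ξ =
      if ξ < 0 then Function.leftLim (RS d.1 d.2) 0 else Function.rightLim (RS d.1 d.2) 0}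

/-- Consistency of `RS` at `(ul, ur)`. -/
def ConsistentAt (D : Set (State × State)) (RS : State → State → ℝ → State)
    (ul ur : State) : Prop :=
  ∀ ξo : ℝ,
    ((ul, RS ul ur ξo) ∈ D ∧ (RS ul ur ξo, ur) ∈ D) ∧
    ((∀ ξ, RS ul (RS ul ur ξo) ξ = if ξ < ξo then RS ul ur ξ else RS ul ur ξo) ∧
      (∀ ξ, RS (RS ul ur ξo) ur ξ = if ξ < ξo then RS ul ur ξo else RS ul ur ξ)) ∧
    (∀ ξ, RS ul ur ξ = if ξ < ξo then RS ul (RS ul ur ξo) ξ else RS (RS ul ur ξo) ur ξ)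

/-- Consistence domain. -/
def consistenceDomain (D : Set (State × State)) (RS : State → State → ℝ → State) :
    Set (State × State) :=
  {d ∈ D | ConsistentAt D RS d.1 d.2}

/-- `L¹_loc`-continuity domain. -/
def continuityDomain (D : Set (State × State)) (RS : State → State → ℝ → State) :
    Set (State × State) :=
  {d ∈ D | ∀ ξ₁ ξ₂ : ℝ,
    Tendsto (fun e : State × State =>
      ∫⁻ ξ in Icc ξ₁ ξ₂, ‖RS e.1 e.2 ξ - RS d.1 d.2 ξ‖ₑ) (𝓝[D] d) (𝓝 0)}

/-- `I ⊆ Ω` is an invariant domain of `RS`. -/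
def IsInvariantDomain (D : Set (State × State)) (RS : State → State → ℝ → State)
    (I : Set State) : Prop :=
  I ⊆ Omega ∧ I ×ˢ I ⊆ D ∧ ∀ ul ∈ I, ∀ ur ∈ I, ∀ ξ, RS ul ur ξ ∈ I

/-! ### The two-way electronic pressure valve -/

/-- The pressure jump `|p̌(0, ur) - p̂(0, ul)|` corresponding to a closed valve. -/
def closedJump (a : ℝ) (ul ur : State) : ℝ :=
  |pressure a (check a 0 ur).1 - pressure a (hat a 0 ul).1|

open Classical in
/-- The coupling Riemann solver of the valve: closed (flow `qm = 0` at `ξ = 0`) if the pressure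
jump is at most `M`, open otherwise. -/
def RSv (a M : ℝ) (ul ur : State) (ξ : ℝ) : State :=
  if closedJump a ul ur ≤ M then
    if ξ < 0 then RSp a ul (hat a 0 ul) ξ else RSp a (check a 0 ur) ur ξ
  else RSp a ul ur ξ

/-- The domain `Ω²` of the solver. -/
def domV : Set (State × State) := Omega ×ˢ Omega

/-- `A`: data for which the valve is active (closed). -/
def setA (a M : ℝ) : Set (State × State) := {d ∈ domV | closedJump a d.1 d.2 ≤ M}

/-- `O`: data for which the valve is open. -/
def setO (a M : ℝ) : Set (State × State) := {d ∈ domV | M < closedJump a d.1 d.2}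

/-- `A_N`: the valve is active but does not influence the flow. -/
def setAN (a M : ℝ) : Set (State × State) :=
  {d ∈ setA a M | ∀ ξ, RSv a M d.1 d.2 ξ = RSp a d.1 d.2 ξ}

/-- `A_I`: the valve is active and influences the flow. -/
def setAI (a M : ℝ) : Set (State × State) := setA a M \ setAN a M

/-- The complement of `A_I` in `Ω²`. -/
def setAIc (a M : ℝ) : Set (State × State) := domV \ setAI a M

/-- `O_O`: the valve is open, and open also for the traces at `0` of the Lax solution. -/
def setOO (a M : ℝ) : Set (State × State) :=
  {d ∈ setO a M |
    (Function.leftLim (RSp a d.1 d.2) 0, Function.rightLim (RSp a d.1 d.2) 0) ∈ setO a M}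

/-- `CN_1`. -/
def setCN1 (a M : ℝ) : Set (State × State) :=
  {d ∈ setAI a M | ∀ ξm ξp : ℝ, ξm < 0 → 0 ≤ ξp →
    (d.1, RSv a M d.1 d.2 ξm) ∈ setAIc a M ∧ (RSv a M d.1 d.2 ξp, d.2) ∈ setAIc a M}

/-- `CN_2`. -/
def setCN2 (a M : ℝ) : Set (State × State) :=
  {d ∈ setAIc a M | ∀ ξ : ℝ,
    (d.1, RSv a M d.1 d.2 ξ) ∈ setAIc a M ∧ (RSv a M d.1 d.2 ξ, d.2) ∈ setAIc a M}

/-- The momentum of the Lax solution does not vanish along any of its rarefactions, the end states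
of a rarefaction included. -/
def NonzeroAlongRarefactions (a : ℝ) (ul ur : State) : Prop :=
  ((tilde a ul ur).1 < ul.1 →
    ∀ ξ ∈ Icc (lam1 a ul) (lam1 a (tilde a ul ur)), (RSp a ul ur ξ).2 ≠ 0) ∧
  ((tilde a ul ur).1 < ur.1 →
    ∀ ξ ∈ Icc (lam2 a (tilde a ul ur)) (lam2 a ur), (RSp a ul ur ξ).2 ≠ 0)

/-- `CN_O`. -/
def setCNO (a M : ℝ) : Set (State × State) :=
  {d ∈ setO a M |
    ((d.1, d.1) ∈ setAIc a M ∧ (d.2, d.2) ∈ setAIc a M ∧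
      (d.1, tilde a d.1 d.2) ∈ setAIc a M ∧ (tilde a d.1 d.2, d.2) ∈ setAIc a M) ∧
    NonzeroAlongRarefactions a d.1 d.2}

/-- `CN_A`. -/
def setCNA (a M : ℝ) : Set (State × State) :=
  {d ∈ setA a M | (0 ≤ d.1.2 ∧ d.2.2 ≤ 0) ∧
    (d.1, d.1) ∈ setAIc a M ∧ (d.2, d.2) ∈ setAIc a M}

/-- The set `I_{u₀} = {u ∈ Ω : z(u) ≥ z(u₀), w(u) ≤ w(u₀)}`. -/
def invRegion (a : ℝ) (u₀ : State) : Set State :=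
  {u ∈ Omega | invZ a u₀ ≤ invZ a u ∧ invW a u ≤ invW a u₀}

end

end GasValve

/-!
In the logarithmic coordinates `(log ρ, v / a)`, and with speeds in units of `a`, the wave curves
and the profiles no longer depend on `a`, and every 1-rarefaction is a straight segment along which
the sum of the two coordinates is constant. The reflection `x ↦ -x`, `q ↦ -q` exchanges the two
families of waves, so only waves of the first family have to be studied. Profiles are functions of
the one-sided points `x⁻` and `x⁺`, because right-continuous representatives are not stable under
this reflection.

The Lax solver is coherent and consistent, so the valve can fail to be coherent or consistent only
where it acts on the traces or on the two halves of a profile, that is where their closed-valve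
pressure jump is at most `M` although their middle state is moving. When the valve is closed both
traces are at rest, and a state at rest is its own middle state. A rarefaction that crosses `q = 0`,
or that ends at a moving state of zero jump, always meets such a pair. Finally, the jump is
continuous and is not locally constant, and at a datum with jump exactly `M` the Lax profile differs
from the closed-valve profile: this is the only discontinuity.
-/

namespace GasValve

noncomputable section

/-! ### The inverse of `prof` -/

theorem prof_zero : prof 0 = 0 := by simp [prof]

theorem prof_of_nonpos {t : ℝ} (h : t ≤ 0) : prof t = t := if_pos h

theorem prof_of_pos {t : ℝ} (h : 0 < t) : prof t = Real.exp (t / 2) - Real.exp (-(t / 2)) := by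
  rw [prof, if_neg h.not_ge, Real.sinh_eq]; ring

theorem prof_surjective : Function.Surjective prof :=
  prof_continuous.surjective prof_atTop prof_atBot

theorem sub_le_prof_sub {s t : ℝ} (h : s ≤ t) : t - s ≤ prof t - prof s := by
  have key := Real.sinh_sub_id_strictMono.monotone (show s / 2 ≤ t / 2 by linarith)
  unfold prof
  split_ifs with h1 h2 h2
  · exact le_rfl
  · linarith
  · have : t / 2 ≤ Real.sinh (t / 2) := Real.self_le_sinh_iff.2 (by linarith)
    linarith
  · linarith

/-- The inverse of `prof`, as an order isomorphism. -/
def profInv : ℝ ≃o ℝ := (prof_strictMono.orderIsoOfSurjective prof prof_surjective).symm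

theorem prof_profInv (y : ℝ) : prof (profInv y) = y := profInv.symm_apply_apply y

theorem profInv_prof (t : ℝ) : profInv (prof t) = t := profInv.apply_symm_apply t

theorem profInv_of_nonpos {y : ℝ} (h : y ≤ 0) : profInv y = y := by
  conv_lhs => rw [← prof_of_nonpos h, profInv_prof]

theorem profInv_sub_le {s t : ℝ} (h : s ≤ t) : profInv t - profInv s ≤ t - s := by
  simpa [prof_profInv] using sub_le_prof_sub (profInv.monotone h)

/-! ### Lax curves in logarithmic coordinates -/

/-- The mirror image `x ↦ -x` of a state, given by its density and momentum or by its log-density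
and velocity. It exchanges the two families of waves, so that a backward Lax curve of the second
family through `q` is the mirror image of the forward Lax curve of the first family through
`reflect q`. -/
def reflect (p : ℝ × ℝ) : ℝ × ℝ := (p.1, -p.2)

@[simp] theorem reflect_fst (p : ℝ × ℝ) : (reflect p).1 = p.1 := rfl

@[simp] theorem reflect_snd (p : ℝ × ℝ) : (reflect p).2 = -p.2 := rfl

@[simp] theorem reflect_reflect (p : ℝ × ℝ) : reflect (reflect p) = p := by simp [reflect]

theorem reflect_eq_iff {p q : ℝ × ℝ} : reflect p = q ↔ p = reflect q :=
  Function.Involutive.eq_iff reflect_reflect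

@[fun_prop]
theorem continuous_reflect : Continuous reflect := by unfold reflect; fun_prop

theorem BL2_eq_neg_FL1 (a ρ : ℝ) (u : State) : BL2 a ρ u = -FL1 a ρ (reflect u) := by
  rw [BL2, FL1, R1, R2, S1, S2, reflect_fst, reflect_snd]
  split_ifs <;> ring

/-- The state with log-density `p.1` and velocity `a * p.2`. -/
def toState (a : ℝ) (p : ℝ × ℝ) : State := (Real.exp p.1, Real.exp p.1 * (a * p.2))

theorem toState_mem (a : ℝ) (p : ℝ × ℝ) : toState a p ∈ Omega := Real.exp_pos p.1

theorem toState_fst (a : ℝ) (p : ℝ × ℝ) : (toState a p).1 = Real.exp p.1 := rfl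

theorem reflect_toState (a : ℝ) (p : ℝ × ℝ) : reflect (toState a p) = toState a (reflect p) := by
  simp [toState, reflect]

theorem vel_toState (a : ℝ) (p : ℝ × ℝ) : vel (toState a p) = a * p.2 :=
  mul_div_cancel_left₀ _ (Real.exp_pos _).ne'

theorem FL1_toState (a t : ℝ) (p : ℝ × ℝ) :
    FL1 a (Real.exp t) (toState a p) = (toState a (t, p.2 - prof (t - p.1))).2 := by
  rw [FL1_exp a t (toState_mem a p), vel_toState, toState_fst, Real.log_exp, toState, mul_sub a]

/-- `s` lies on the forward Lax curve of the first family through `p`, where states are given by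
their log-density and their velocity in units of `a`. -/
def OnLax (p s : ℝ × ℝ) : Prop := s.2 = p.2 - prof (s.1 - p.1)

theorem OnLax.refl (p : ℝ × ℝ) : OnLax p p := by simp [OnLax, prof_zero]

theorem OnLax.snd_lt {p s : ℝ × ℝ} (h : OnLax p s) (hps : p.1 < s.1) : s.2 < p.2 := by
  have := prof_strictMono (sub_pos.2 hps)
  rw [prof_zero] at this
  rw [h]
  linarith

theorem OnLax.add_eq {p s : ℝ × ℝ} (h : OnLax p s) (hps : s.1 ≤ p.1) :
    s.1 + s.2 = p.1 + p.2 := by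
  rw [h, prof_of_nonpos (by linarith)]
  ring

theorem onLax_of_add_eq {p s : ℝ × ℝ} (h : s.1 + s.2 = p.1 + p.2) (hps : s.1 ≤ p.1) :
    OnLax p s := by
  rw [OnLax, prof_of_nonpos (by linarith)]
  linarith

theorem FL1_toState_eq_BL2_toState_iff {a : ℝ} (ha : 0 < a) {t : ℝ} {p q : ℝ × ℝ} :
    FL1 a (Real.exp t) (toState a p) = BL2 a (Real.exp t) (toState a q) ↔
      ∃ v, OnLax p (t, v) ∧ OnLax (reflect q) (reflect (t, v)) := by
  simp only [BL2_eq_neg_FL1, reflect_toState, FL1_toState]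
  simp only [toState, OnLax, reflect, ← mul_neg, mul_right_inj' (Real.exp_pos t).ne',
    mul_right_inj' ha.ne', exists_eq_left]
  constructor <;> intro h <;> linarith

theorem existsUnique_middle (p q : ℝ × ℝ) :
    ∃! s, OnLax p s ∧ OnLax (reflect q) (reflect s) := by
  obtain ⟨ρ, ⟨hρ, heq⟩, huniq⟩ := existsUnique_tilde one_pos (toState_mem 1 p) (toState_mem 1 q)
  rw [← Real.exp_log hρ, FL1_toState_eq_BL2_toState_iff one_pos] at heq
  obtain ⟨v, hv⟩ := heq
  refine ⟨_, hv, fun s hs => ?_⟩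
  have hs₁ : s.1 = Real.log ρ := by
    rw [← Real.log_exp s.1, huniq _ ⟨Real.exp_pos _,
      (FL1_toState_eq_BL2_toState_iff one_pos).2 ⟨s.2, hs⟩⟩]
  ext
  · exact hs₁
  · rw [hs.1, hv.1, hs₁]

/-- The intermediate state of the Lax solution of the Riemann problem, i.e. `ũ`. -/
def middle (p q : ℝ × ℝ) : ℝ × ℝ := (existsUnique_middle p q).choose

theorem onLax_middle (p q : ℝ × ℝ) : OnLax p (middle p q) :=
  (existsUnique_middle p q).choose_spec.1.1

theorem onLax_reflect_middle (p q : ℝ × ℝ) : OnLax (reflect q) (reflect (middle p q)) :=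
  (existsUnique_middle p q).choose_spec.1.2

theorem eq_middle {p q s : ℝ × ℝ} (h₁ : OnLax p s) (h₂ : OnLax (reflect q) (reflect s)) :
    middle p q = s :=
  (existsUnique_middle p q).unique ⟨onLax_middle p q, onLax_reflect_middle p q⟩ ⟨h₁, h₂⟩

theorem OnLax.middle_eq {p s : ℝ × ℝ} (h : OnLax p s) : middle p s = s :=
  eq_middle h (OnLax.refl _)

theorem middle_reflect (p q : ℝ × ℝ) :
    middle (reflect q) (reflect p) = reflect (middle p q) :=
  eq_middle (onLax_reflect_middle p q) (by simpa using onLax_middle p q)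

/-- The state at rest on the forward Lax curve of the first family through `p`, i.e. `û`. The state
at rest `ǔ` on the backward Lax curve of the second family through `q` is `wall (reflect q)`,
being its own mirror image. -/
def wall (p : ℝ × ℝ) : ℝ × ℝ := (p.1 + profInv p.2, 0)

@[simp] theorem wall_snd (p : ℝ × ℝ) : (wall p).2 = 0 := rfl

@[simp] theorem reflect_wall (p : ℝ × ℝ) : reflect (wall p) = wall p := by simp [reflect, wall]

theorem onLax_wall (p : ℝ × ℝ) : OnLax p (wall p) := by simp [OnLax, wall, prof_profInv]

theorem eq_wall {p s : ℝ × ℝ} (h : OnLax p s) (hs : s.2 = 0) : s = wall p := by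
  have hprof : prof (s.1 - p.1) = p.2 := by rw [OnLax] at h; linarith
  ext
  · rw [wall, ← hprof, profInv_prof]; ring
  · exact hs

theorem wall_of_snd_eq_zero {p : ℝ × ℝ} (hp : p.2 = 0) : wall p = p :=
  (eq_wall (OnLax.refl p) hp).symm

theorem wall_wall (p : ℝ × ℝ) : wall (wall p) = wall p := wall_of_snd_eq_zero rfl

/-- The pressure jump across the closed valve, in units of `a ^ 2`. -/
def jump (p q : ℝ × ℝ) : ℝ := |Real.exp (wall (reflect q)).1 - Real.exp (wall p).1|

theorem jump_reflect (p q : ℝ × ℝ) : jump (reflect q) (reflect p) = jump p q := by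
  rw [jump, jump, reflect_reflect, abs_sub_comm]

theorem middle_eq_wall {p q : ℝ × ℝ} (h : (middle p q).2 = 0) :
    middle p q = wall p ∧ middle p q = wall (reflect q) :=
  ⟨eq_wall (onLax_middle p q) h, by
    rw [← eq_wall (onLax_reflect_middle p q) (by simp [h]), eq_comm, reflect_eq_iff]
    ext <;> simp [h]⟩

theorem jump_eq_zero_of_middle {p q : ℝ × ℝ} (h : (middle p q).2 = 0) : jump p q = 0 := by
  rw [jump, ← (middle_eq_wall h).1, ← (middle_eq_wall h).2, sub_self, abs_zero]

/-! ### One-sided points -/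

/-- A real number `x` approached from one side: `x⁻` or `x⁺`. A self-similar profile with traces is
a function of one-sided points, and unlike right-continuous representatives such functions are
stable under the reflection `x ↦ -x`. -/
abbrev OneSided := ℝ ×ₗ Bool

/-- The one-sided point `x⁺` if `b` is true, `x⁻` otherwise. -/
def side (b : Bool) (x : ℝ) : OneSided := toLex (x, b)

/-- The one-sided point `x⁻`. -/
abbrev below (x : ℝ) : OneSided := side false x

/-- The one-sided point `x⁺`. -/
abbrev above (x : ℝ) : OneSided := side true x

/-- The real number underlying a one-sided point. -/
def OneSided.pos (ξ : OneSided) : ℝ := (ofLex ξ).1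

/-- The reflection `x⁻ ↦ (-x)⁺`, `x⁺ ↦ (-x)⁻`. -/
def OneSided.flip (ξ : OneSided) : OneSided := side (!(ofLex ξ).2) (-ξ.pos)

namespace OneSided

@[simp] theorem pos_side (b : Bool) (x : ℝ) : (side b x).pos = x := rfl

@[simp] theorem flip_side (b : Bool) (x : ℝ) : (side b x).flip = side (!b) (-x) := rfl

@[simp] theorem pos_flip (ξ : OneSided) : ξ.flip.pos = -ξ.pos := rfl

theorem forall_iff {P : OneSided → Prop} : (∀ ξ, P ξ) ↔ ∀ b x, P (side b x) :=
  ⟨fun h _ _ => h _, fun h ξ => h (ofLex ξ).2 (ofLex ξ).1⟩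

@[simp] theorem flip_flip (ξ : OneSided) : ξ.flip.flip = ξ :=
  (forall_iff (P := fun ξ => ξ.flip.flip = ξ)).2 (by simp) ξ

theorem side_le_side {b c : Bool} {x y : ℝ} :
    side b x ≤ side c y ↔ x < y ∨ x = y ∧ (b = true → c = true) := by
  rw [← Bool.le_iff_imp]
  exact Prod.Lex.toLex_le_toLex

theorem above_le_below {x y : ℝ} : above x ≤ below y ↔ x < y := by simp [side_le_side]

theorem le_below_of_pos_lt {ξ : OneSided} {y : ℝ} (h : ξ.pos < y) : ξ ≤ below y :=
  Prod.Lex.le_iff.2 (.inl h)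

theorem not_le_below_of_lt_pos {ξ : OneSided} {y : ℝ} (h : y < ξ.pos) : ¬ξ ≤ below y :=
  not_le.2 (Prod.Lex.lt_iff.2 (.inl h))

theorem pos_le_of_le_below {ξ : OneSided} {y : ℝ} (h : ξ ≤ below y) : ξ.pos ≤ y :=
  not_lt.1 fun hlt => not_le_below_of_lt_pos hlt h

theorem le_pos_of_not_le_below {ξ : OneSided} {y : ℝ} (h : ¬ξ ≤ below y) : y ≤ ξ.pos :=
  not_lt.1 fun hlt => h (le_below_of_pos_lt hlt)

theorem monotone_pos : Monotone pos := fun ξ η h => by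
  rcases Prod.Lex.le_iff.1 h with h | h
  exacts [h.le, h.1.le]

theorem antitone_flip : Antitone flip := by
  simp only [Antitone, forall_iff, flip_side, side_le_side]
  rintro b x c y (h | ⟨rfl, h⟩)
  · exact .inl (neg_lt_neg h)
  · exact .inr ⟨rfl, by cases b <;> simp_all⟩

theorem flip_min (ξ η : OneSided) : (min ξ η).flip = max ξ.flip η.flip := antitone_flip.map_min

theorem flip_le_below_neg_iff {ξ : OneSided} {y : ℝ} : ξ.flip ≤ below (-y) ↔ ¬ξ ≤ below y := by
  revert ξ
  rw [forall_iff]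
  rintro (_ | _) x <;> simp [side_le_side] <;> grind

theorem above_le_iff_not_le_below {ξ : OneSided} {y : ℝ} : above y ≤ ξ ↔ ¬ξ ≤ below y := by
  revert ξ
  rw [forall_iff]
  rintro (_ | _) x <;> simp [side_le_side] <;> grind

theorem lt_below_iff {ξ : OneSided} {y : ℝ} : ξ < below y ↔ ξ.pos < y := by
  simp [Prod.Lex.lt_iff, below, side, pos]

theorem above_lt_iff {ξ : OneSided} {x : ℝ} : above x < ξ ↔ x < ξ.pos := by
  simp [Prod.Lex.lt_iff, above, side, pos]

end OneSided

/-! ### Waves and the Lax solver -/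

/-- The speed of the shock from `p` to a state with log-density `t` on its Lax curve. -/
def jumpSpeed (p : ℝ × ℝ) (t : ℝ) : ℝ := p.2 - Real.exp ((t - p.1) / 2)

/-- The profile of the wave of the first family from `p` to `s`, in logarithmic coordinates and
with speeds in units of `a`. Inside a rarefaction the first eigenvalue is `s.2 - 1`, and `s.1 + s.2`
is constant. -/
def wave (p s : ℝ × ℝ) (ξ : OneSided) : ℝ × ℝ :=
  if p.1 < s.1 then
    if ξ ≤ below (jumpSpeed p s.1) then p else s
  else
    let c := max p.2 (min (ξ.pos + 1) s.2)
    (p.1 + p.2 - c, c)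

/-- The profile of the wave of the second family from `s` to `q`. -/
def wave' (s q : ℝ × ℝ) (ξ : OneSided) : ℝ × ℝ :=
  reflect (wave (reflect q) (reflect s) ξ.flip)

theorem reflect_wave (p s : ℝ × ℝ) (ξ : OneSided) :
    reflect (wave p s ξ) = wave' (reflect s) (reflect p) ξ.flip := by simp [wave']

theorem reflect_wave' (s q : ℝ × ℝ) (ξ : OneSided) :
    reflect (wave' s q ξ) = wave (reflect q) (reflect s) ξ.flip := by simp [wave']

theorem wave_self (p : ℝ × ℝ) (ξ : OneSided) : wave p p ξ = p := by simp [wave]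

theorem wave'_self (p : ℝ × ℝ) (ξ : OneSided) : wave' p p ξ = p := by simp [wave', wave_self]

/-- The Lax solver in logarithmic coordinates: the wave of the second family from the middle state
to `q` is the mirror image of a wave of the first family. -/
def lax (p q : ℝ × ℝ) (ξ : OneSided) : ℝ × ℝ :=
  if ξ ≤ below (middle p q).2 then wave p (middle p q) ξ else wave' (middle p q) q ξ

/-- The solver of the closed valve in logarithmic coordinates. -/
def closedValve (p q : ℝ × ℝ) (ξ : OneSided) : ℝ × ℝ :=
  if ξ ≤ below 0 then wave p (wall p) ξ else wave' (wall (reflect q)) q ξ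

open Classical in
/-- The solver of the valve in logarithmic coordinates; `K` is the threshold `M / a ^ 2`. -/
def valve (K : ℝ) (p q : ℝ × ℝ) (ξ : OneSided) : ℝ × ℝ :=
  if jump p q ≤ K then closedValve p q ξ else lax p q ξ

theorem valve_of_le {K : ℝ} {p q : ℝ × ℝ} (h : jump p q ≤ K) : valve K p q = closedValve p q :=
  funext fun _ => if_pos h

theorem valve_of_lt {K : ℝ} {p q : ℝ × ℝ} (h : K < jump p q) : valve K p q = lax p q :=
  funext fun _ => if_neg h.not_ge

theorem lax_reflect (p q : ℝ × ℝ) (ξ : OneSided) :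
    lax (reflect q) (reflect p) ξ = reflect (lax p q ξ.flip) := by
  have hside : ξ ≤ below (-(middle p q).2) ↔ ¬ξ.flip ≤ below (middle p q).2 := by
    rw [← OneSided.flip_le_below_neg_iff, OneSided.flip_flip]
  simp only [lax, middle_reflect, reflect_snd, hside, apply_ite reflect, reflect_wave,
    reflect_wave', OneSided.flip_flip, ite_not]

theorem closedValve_reflect (p q : ℝ × ℝ) (ξ : OneSided) :
    closedValve (reflect q) (reflect p) ξ = reflect (closedValve p q ξ.flip) := by
  have hside : ξ ≤ below 0 ↔ ¬ξ.flip ≤ below 0 := by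
    rw [← OneSided.flip_le_below_neg_iff, OneSided.flip_flip, neg_zero]
  simp only [closedValve, hside, apply_ite reflect, reflect_wave, reflect_wave',
    OneSided.flip_flip, ite_not, reflect_reflect, reflect_wall]

theorem valve_reflect (K : ℝ) (p q : ℝ × ℝ) (ξ : OneSided) :
    valve K (reflect q) (reflect p) ξ = reflect (valve K p q ξ.flip) := by
  simp only [valve, jump_reflect, apply_ite reflect, closedValve_reflect, lax_reflect]

theorem wave_of_lt {p s : ℝ × ℝ} (hps : p.1 < s.1) (ξ : OneSided) :
    wave p s ξ = if ξ ≤ below (jumpSpeed p s.1) then p else s := if_pos hps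

theorem wave_of_le {p s : ℝ × ℝ} (hps : s.1 ≤ p.1) (ξ : OneSided) :
    wave p s ξ = (p.1 + p.2 - max p.2 (min (ξ.pos + 1) s.2), max p.2 (min (ξ.pos + 1) s.2)) :=
  if_neg hps.not_gt

theorem OnLax.jumpSpeed_lt {p s : ℝ × ℝ} (h : OnLax p s) (hps : p.1 < s.1) :
    jumpSpeed p s.1 < s.2 := by
  rw [h, prof_of_pos (sub_pos.2 hps), jumpSpeed]
  linarith [Real.exp_pos (-((s.1 - p.1) / 2))]

theorem OnLax.snd_le {p s : ℝ × ℝ} (h : OnLax p s) (hps : s.1 ≤ p.1) : p.2 ≤ s.2 := by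
  linarith [h.add_eq hps]

theorem OnLax.exists_wave_eq_right {p s : ℝ × ℝ} (h : OnLax p s) :
    ∃ y < s.2, ∀ ξ : OneSided, y < ξ.pos → wave p s ξ = s := by
  rcases lt_or_ge p.1 s.1 with hps | hps
  · refine ⟨_, h.jumpSpeed_lt hps, fun ξ hξ => ?_⟩
    rw [wave_of_lt hps, if_neg (OneSided.not_le_below_of_lt_pos hξ)]
  · refine ⟨s.2 - 1, by linarith, fun ξ hξ => ?_⟩
    rw [wave_of_le hps, min_eq_right (by linarith), max_eq_right (h.snd_le hps),
      ← h.add_eq hps, add_sub_cancel_right]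

theorem OnLax.wave_eq_right {p s : ℝ × ℝ} (h : OnLax p s) {ξ : OneSided} (hξ : s.2 ≤ ξ.pos) :
    wave p s ξ = s := by
  obtain ⟨y, hy, hwave⟩ := h.exists_wave_eq_right
  exact hwave ξ (hy.trans_le hξ)

theorem wave_min (p s : ℝ × ℝ) (ξ η : OneSided) :
    wave p (wave p s η) ξ = wave p s (min ξ η) := by
  rcases lt_or_ge p.1 s.1 with hps | hps
  · by_cases hη : η ≤ below (jumpSpeed p s.1)
    · rw [wave_of_lt hps, if_pos hη, wave_self, wave_of_lt hps, if_pos (min_le_of_right_le hη)]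
    · simp only [wave_of_lt hps, if_neg hη, min_le_iff, or_iff_left hη]
  · have hstep : p.1 + p.2 - max p.2 (min (η.pos + 1) s.2) ≤ p.1 := by
      linarith [le_max_left p.2 (min (η.pos + 1) s.2)]
    have hmax : max p.2 (min (ξ.pos + 1) (max p.2 (min (η.pos + 1) s.2))) =
        max p.2 (min ((min ξ η).pos + 1) s.2) := by
      rw [OneSided.monotone_pos.map_min, ← min_add_add_right]
      grind
    simp only [wave_of_le hps, wave_of_le (s := (_, _)) hstep, hmax]

theorem OnLax.wave_max {p s : ℝ × ℝ} (h : OnLax p s) (ξ η : OneSided) :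
    wave (wave p s η) s ξ = wave p s (max ξ η) := by
  rcases lt_or_ge p.1 s.1 with hps | hps
  · by_cases hη : η ≤ below (jumpSpeed p s.1)
    · simp only [wave_of_lt hps, if_pos hη, max_le_iff, and_iff_left hη]
    · rw [wave_of_lt hps, if_neg hη, wave_self, wave_of_lt hps,
        if_neg (mt (le_max_right ξ η).trans hη)]
  · have hstep : s.1 ≤ p.1 + p.2 - max p.2 (min (η.pos + 1) s.2) := by
      linarith [h.add_eq hps, max_le (h.snd_le hps) (min_le_right (η.pos + 1) s.2)]
    have hmax : max (max p.2 (min (η.pos + 1) s.2)) (min (ξ.pos + 1) s.2) =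
        max p.2 (min ((max ξ η).pos + 1) s.2) := by
      rw [OneSided.monotone_pos.map_max]
      grind
    simp only [wave_of_le hps, wave_of_le (p := (_, _)) hstep, hmax, sub_add_cancel]

theorem OnLax.onLax_wave {p s : ℝ × ℝ} (h : OnLax p s) (ξ : OneSided) :
    OnLax p (wave p s ξ) ∧ OnLax (wave p s ξ) s := by
  rcases lt_or_ge p.1 s.1 with hps | hps
  · rw [wave_of_lt hps]
    split_ifs
    exacts [⟨.refl p, h⟩, ⟨h, .refl s⟩]
  · have hle := max_le (h.snd_le hps) (min_le_right (ξ.pos + 1) s.2)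
    rw [wave_of_le hps]
    exact ⟨onLax_of_add_eq (sub_add_cancel _ _) (by simp),
      onLax_of_add_eq ((h.add_eq hps).trans (sub_add_cancel _ _).symm)
        (by linarith [h.add_eq hps])⟩

theorem OnLax.forall_wave_iff {p s : ℝ × ℝ} (h : OnLax p s) (b : Bool) {P : ℝ × ℝ → Prop} :
    (∀ x, P (wave p s (side b x))) ↔
      P p ∧ P s ∧ (s.1 < p.1 → ∀ c ∈ Icc p.2 s.2, P (p.1 + p.2 - c, c)) := by
  rcases lt_or_ge p.1 s.1 with hps | hps
  · simp only [wave_of_lt hps]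
    constructor
    · intro hP
      have hleft := hP (jumpSpeed p s.1 - 1)
      have hright := hP (jumpSpeed p s.1 + 1)
      rw [if_pos (OneSided.le_below_of_pos_lt (sub_one_lt _))] at hleft
      rw [if_neg (OneSided.not_le_below_of_lt_pos (lt_add_one _))] at hright
      exact ⟨hleft, hright, fun hsp => absurd hps hsp.not_gt⟩
    · rintro ⟨hp, hs, -⟩ x
      split_ifs
      exacts [hp, hs]
  · have hadd := h.add_eq hps
    have hIcc : (∀ x, P (wave p s (side b x))) ↔
        ∀ c ∈ Icc p.2 s.2, P (p.1 + p.2 - c, c) := by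
      simp only [wave_of_le hps, OneSided.pos_side]
      refine ⟨fun hP c hc => ?_, fun hP x => hP _ ⟨le_max_left _ _, ?_⟩⟩
      · simpa [min_eq_left hc.2, max_eq_right hc.1] using hP (c - 1)
      · exact max_le (h.snd_le hps) (min_le_right _ _)
    have hleft : (p.1 + p.2 - p.2, p.2) = p := by simp
    have hright : (p.1 + p.2 - s.2, s.2) = s := by simp [← hadd]
    rw [hIcc]
    refine ⟨fun hP => ⟨hleft ▸ hP _ (left_mem_Icc.2 (h.snd_le hps)),
      hright ▸ hP _ (right_mem_Icc.2 (h.snd_le hps)), fun _ => hP⟩, fun hP c hc => ?_⟩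
    rcases hps.lt_or_eq with hlt | heq
    · exact hP.2.2 hlt c hc
    · rw [show c = p.2 by linarith [hc.1, hc.2], hleft]
      exact hP.1

theorem lax_of_le {p q : ℝ × ℝ} {ξ : OneSided} (hξ : ξ ≤ below (middle p q).2) :
    lax p q ξ = wave p (middle p q) ξ := if_pos hξ

theorem lax_of_not_le {p q : ℝ × ℝ} {ξ : OneSided} (hξ : ¬ξ ≤ below (middle p q).2) :
    lax p q ξ = wave' (middle p q) q ξ := if_neg hξ

theorem OnLax.wave'_eq_left {s q : ℝ × ℝ} (h : OnLax (reflect q) (reflect s)) {ξ : OneSided}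
    (hξ : ξ.pos ≤ s.2) : wave' s q ξ = s := by
  rw [wave', h.wave_eq_right (by simpa using hξ), reflect_reflect]

theorem OnLax.lax_eq {p s : ℝ × ℝ} (h : OnLax p s) : lax p s = wave p s := by
  ext1 ξ
  rw [lax, h.middle_eq]
  split_ifs with hξ
  · rfl
  · rw [wave'_self, h.wave_eq_right (OneSided.le_pos_of_not_le_below hξ)]

theorem OnLax.lax_eq' {s q : ℝ × ℝ} (h : OnLax (reflect q) (reflect s)) :
    lax s q = wave' s q := by
  ext1 ξ
  rw [lax, eq_middle (.refl s) h]
  split_ifs with hξ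
  · rw [wave_self, h.wave'_eq_left (OneSided.pos_le_of_le_below hξ)]
  · rfl

theorem lax_min (p q : ℝ × ℝ) (ξ η : OneSided) : lax p (lax p q η) ξ = lax p q (min ξ η) := by
  by_cases hη : η ≤ below (middle p q).2
  · rw [lax_of_le hη, ((onLax_middle p q).onLax_wave η).1.lax_eq, wave_min,
      lax_of_le (min_le_of_right_le hη)]
  · set u := wave' (middle p q) q η with hu
    have hmu : middle p u = middle p q := by
      refine eq_middle (onLax_middle p q) ?_
      rw [hu, reflect_wave']
      exact ((onLax_reflect_middle p q).onLax_wave _).2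
    have hwave' : wave' (middle p q) u ξ = wave' (middle p q) q (min ξ η) := by
      rw [wave', hu, reflect_wave', (onLax_reflect_middle p q).wave_max, wave',
        OneSided.flip_min]
    rw [lax_of_not_le hη, ← hu, lax, hmu, hwave']
    split_ifs with hξ
    · rw [min_eq_left (hξ.trans (not_le.1 hη).le), lax_of_le hξ]
    · rw [lax_of_not_le (by simp [hξ, hη])]

theorem lax_max (p q : ℝ × ℝ) (ξ η : OneSided) : lax (lax p q η) q ξ = lax p q (max ξ η) := by
  have h := lax_min (reflect q) (reflect p) ξ.flip η.flip
  rwa [lax_reflect p q, OneSided.flip_flip, lax_reflect, OneSided.flip_flip, lax_reflect,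
    OneSided.flip_min, OneSided.flip_flip, OneSided.flip_flip,
    reflect_eq_iff, reflect_reflect] at h

theorem lax_interface (p q : ℝ × ℝ) (y : ℝ) (ξ : OneSided) :
    lax (lax p q (below y)) (lax p q (above y)) ξ =
      if ξ ≤ below y then lax p q (below y) else lax p q (above y) := by
  have hy : below y ≤ above y := by simp [OneSided.side_le_side]
  have hright : lax p q (above y) = lax (lax p q (below y)) q (above y) := by
    rw [lax_max, max_eq_left hy]
  rw [hright, lax_min, lax_max, lax_max, max_eq_left hy]
  split_ifs with hξ
  · rw [max_eq_right (min_le_of_left_le hξ)]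
  · rw [min_eq_right (OneSided.above_le_iff_not_le_below.2 hξ), max_eq_left hy]

theorem forall_lax_iff (p q : ℝ × ℝ) (b : Bool) {P : ℝ × ℝ → Prop} :
    (∀ x, P (lax p q (side b x))) ↔ (∀ x, P (wave p (middle p q) (side b x))) ∧
      ∀ x, P (wave' (middle p q) q (side b x)) := by
  have h₁ := onLax_middle p q
  have h₂ := onLax_reflect_middle p q
  refine ⟨fun h => ?_, fun h x => ?_⟩
  · have hm : P (middle p q) := by
      obtain ⟨y, hy, hwave⟩ := h₁.exists_wave_eq_right
      obtain ⟨x, hyx, hx⟩ := exists_between hy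
      simpa only [lax_of_le (OneSided.le_below_of_pos_lt (ξ := side b x) hx),
        hwave (side b x) hyx] using h x
    refine ⟨fun x => ?_, fun x => ?_⟩ <;>
      by_cases hx : side b x ≤ below (middle p q).2
    · simpa only [lax_of_le hx] using h x
    · rwa [h₁.wave_eq_right (OneSided.le_pos_of_not_le_below hx)]
    · rwa [h₂.wave'_eq_left (OneSided.pos_le_of_le_below hx)]
    · simpa only [lax_of_not_le hx] using h x
  · rw [lax]
    split_ifs
    exacts [h.1 x, h.2 x]

theorem lax_snd_pos {p q : ℝ × ℝ} (hm : 0 < (middle p q).2) {ξ : OneSided} (hξ : ξ.pos = 0) :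
    0 < (lax p q ξ).2 := by
  have h := onLax_middle p q
  rw [lax_of_le (OneSided.le_below_of_pos_lt (hξ.trans_lt hm))]
  rcases lt_or_ge p.1 (middle p q).1 with hlt | hle
  · rw [wave_of_lt hlt]
    split_ifs
    exacts [hm.trans (h.snd_lt hlt), hm]
  · rw [wave_of_le hle, hξ]
    exact lt_max_of_lt_right (lt_min (by norm_num) hm)

theorem lax_of_middle_snd_eq_zero {p q : ℝ × ℝ} (hm : (middle p q).2 = 0) :
    lax p q = closedValve p q := by
  ext1 ξ
  rw [lax, hm, closedValve, ← (middle_eq_wall hm).1, ← (middle_eq_wall hm).2]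

theorem closedValve_of_le {p q : ℝ × ℝ} {ξ : OneSided} (hξ : ξ ≤ below 0) :
    closedValve p q ξ = wave p (wall p) ξ := if_pos hξ

theorem closedValve_of_not_le {p q : ℝ × ℝ} {ξ : OneSided} (hξ : ¬ξ ≤ below 0) :
    closedValve p q ξ = wave' (wall (reflect q)) q ξ := if_neg hξ

theorem closedValve_of_pos_eq_zero {p q : ℝ × ℝ} {ξ : OneSided} (hξ : ξ.pos = 0) :
    closedValve p q ξ = if ξ ≤ below 0 then wall p else wall (reflect q) := by
  rw [closedValve, (onLax_wall p).wave_eq_right hξ.ge,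
    OnLax.wave'_eq_left (by simpa using onLax_wall (reflect q)) hξ.le]

theorem closedValve_snd {p q : ℝ × ℝ} {ξ : OneSided} (hξ : ξ.pos = 0) :
    (closedValve p q ξ).2 = 0 := by
  rw [closedValve_of_pos_eq_zero hξ]
  split_ifs <;> rfl

theorem lax_snd_eq_zero_iff {p q : ℝ × ℝ} {ξ : OneSided} (hξ : ξ.pos = 0) :
    (lax p q ξ).2 = 0 ↔ (middle p q).2 = 0 := by
  refine ⟨fun h => ?_, fun hm => by rw [lax_of_middle_snd_eq_zero hm, closedValve_snd hξ]⟩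
  rcases lt_trichotomy (middle p q).2 0 with hm | hm | hm
  · have hpos : 0 < (lax (reflect q) (reflect p) ξ.flip).2 :=
      lax_snd_pos (by simpa [middle_reflect] using hm) (by simpa using hξ)
    simp [lax_reflect, h] at hpos
  · exact hm
  · exact absurd h (lax_snd_pos hm hξ).ne'

/-! ### Coherence and consistence in logarithmic coordinates -/

/-- The valve does not influence the flow, i.e. the data are in `𝖠_𝖨ᶜ`. -/
def Unaffected (K : ℝ) (p q : ℝ × ℝ) : Prop := K < jump p q ∨ (middle p q).2 = 0

theorem unaffected_reflect {K : ℝ} {p q : ℝ × ℝ} :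
    Unaffected K (reflect q) (reflect p) ↔ Unaffected K p q := by
  simp [Unaffected, jump_reflect, middle_reflect]

theorem Unaffected.valve_eq {K : ℝ} {p q : ℝ × ℝ} (h : Unaffected K p q) :
    valve K p q = lax p q := by
  rcases lt_or_ge K (jump p q) with hlt | hle
  · exact valve_of_lt hlt
  · rw [valve_of_le hle, lax_of_middle_snd_eq_zero (h.resolve_left hle.not_gt)]

theorem unaffected_iff {K : ℝ} {p q : ℝ × ℝ} (b : Bool) :
    Unaffected K p q ↔ ∀ x, valve K p q (side b x) = lax p q (side b x) := by
  refine ⟨fun h x => by rw [h.valve_eq], fun h => or_iff_not_imp_left.2 fun hle => ?_⟩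
  rw [← lax_snd_eq_zero_iff (OneSided.pos_side b 0), ← h 0, valve_of_le (not_lt.1 hle),
    closedValve_snd (OneSided.pos_side b 0)]

theorem valve_coherent_iff {K : ℝ} {p q : ℝ × ℝ} :
    (∀ x, valve K (valve K p q (below 0)) (valve K p q (above 0)) (above x) =
        if x < 0 then valve K p q (below 0) else valve K p q (above 0)) ↔
      (K < jump p q → K < jump (lax p q (below 0)) (lax p q (above 0))) := by
  rcases le_or_gt (jump p q) K with hle | hlt
  · refine iff_of_true (fun x => ?_) fun h => absurd h hle.not_gt
    have hleft : closedValve p q (below 0) = wall p := by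
      rw [closedValve_of_pos_eq_zero rfl, if_pos le_rfl]
    have hright : closedValve p q (above 0) = wall (reflect q) := by
      rw [closedValve_of_pos_eq_zero rfl, if_neg (by simp [OneSided.above_le_below])]
    have hjump : jump (wall p) (wall (reflect q)) = jump p q := by
      simp only [jump, reflect_wall, wall_wall]
    rw [valve_of_le hle, hleft, hright, valve_of_le (hjump.trans_le hle), closedValve, wall_wall,
      wave_self, reflect_wall, wall_wall, wave'_self]
    simp only [OneSided.above_le_below]
  · rw [valve_of_lt hlt, forall_prop_of_true hlt]
    refine ⟨fun h => ?_, fun h x => ?_⟩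
    · by_contra! hle
      have hmid : (middle p q).2 = 0 := by
        rw [← lax_snd_eq_zero_iff (OneSided.pos_side true 0)]
        have h₀ := h 0
        rw [valve_of_le hle, if_neg (lt_irrefl 0)] at h₀
        rw [← h₀, closedValve_snd (OneSided.pos_side true 0)]
      rw [jump_eq_zero_of_middle hmid] at hlt
      exact absurd ((abs_nonneg _).trans hle) hlt.not_ge
    · rw [valve_of_lt h, lax_interface]
      simp only [OneSided.above_le_below]

/-- Half of the consistence condition at `(p, q)`: truncating the solution on the right. The other
half is the mirror image, see `leftConsistent_reflect`. The values on one side `b` of each point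
are considered. -/
def LeftConsistent (b : Bool) (K : ℝ) (p q : ℝ × ℝ) : Prop :=
  ∀ x y, valve K p (valve K p q (side b y)) (side b x) = valve K p q (min (side b x) (side b y))

theorem leftConsistent_reflect {b : Bool} {K : ℝ} {p q : ℝ × ℝ} :
    LeftConsistent (!b) K (reflect q) (reflect p) ↔ ∀ x y,
      valve K (valve K p q (side b y)) q (side b x) = valve K p q (max (side b x) (side b y)) := by
  have hneg : Function.Surjective (Neg.neg : ℝ → ℝ) := neg_surjective
  rw [LeftConsistent, hneg.forall₂]
  simp only [valve_reflect, OneSided.flip_min, OneSided.flip_side, Bool.not_not, neg_neg,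
    reflect_eq_iff, reflect_reflect]

theorem Unaffected.leftConsistent_iff {b : Bool} {K : ℝ} {p q : ℝ × ℝ} (h : Unaffected K p q) :
    LeftConsistent b K p q ↔ ∀ y, Unaffected K p (valve K p q (side b y)) := by
  simp only [LeftConsistent, h.valve_eq, unaffected_iff b, lax_min]
  exact forall_comm

theorem leftConsistent_iff_of_jump_le {b : Bool} {K : ℝ} {p q : ℝ × ℝ} (h : jump p q ≤ K) :
    LeftConsistent b K p q ↔ ∀ y, side b y ≤ below 0 → Unaffected K p (valve K p q (side b y)) := by
  rw [LeftConsistent, forall_comm, valve_of_le h]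
  refine forall_congr' fun y => ?_
  by_cases hy : side b y ≤ below 0
  · have hlax := ((onLax_wall p).onLax_wave (side b y)).1.lax_eq
    simp only [hy, true_imp_iff, unaffected_iff b, closedValve_of_le hy, hlax, wave_min,
      closedValve_of_le (min_le_of_right_le hy)]
  · simp only [hy, false_imp_iff, iff_true]
    intro x
    set u := closedValve p q (side b y) with hu
    have hwave : OnLax (reflect u) (wall (reflect q)) := by
      rw [hu, closedValve_of_not_le hy, reflect_wave', reflect_wall]
      exact ((onLax_wall _).onLax_wave _).2
    have hwall : wall (reflect u) = wall (reflect q) := (eq_wall hwave rfl).symm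
    have hjump : jump p u = jump p q := by rw [jump, jump, hwall]
    rw [valve_of_le (hjump.trans_le h), closedValve, hwall]
    split_ifs with hx
    · rw [min_eq_left (hx.trans (not_le.1 hy).le), closedValve_of_le hx]
    · rw [closedValve_of_not_le (by simp [hx, hy]), hu, closedValve_of_not_le hy,
        wave', reflect_wave', reflect_wall, (onLax_wall _).wave_max, wave', reflect_wall,
        OneSided.flip_min]

@[fun_prop]
theorem continuous_wall : Continuous wall :=
  (continuous_fst.add (profInv.continuous.comp continuous_snd)).prodMk continuous_const

@[fun_prop]
theorem continuous_jump : Continuous fun d : (ℝ × ℝ) × (ℝ × ℝ) => jump d.1 d.2 := by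
  unfold jump
  fun_prop

theorem OnLax.fst_eq {p s : ℝ × ℝ} (h : OnLax p s) : s.1 = p.1 + profInv (p.2 - s.2) := by
  rw [h, sub_sub_cancel, profInv_prof, add_sub_cancel]

theorem OnLax.fst_le_wall_iff {p s : ℝ × ℝ} (h : OnLax p s) :
    s.1 ≤ (wall p).1 ↔ 0 ≤ s.2 := by
  rw [h.fst_eq, wall, add_le_add_iff_left, profInv.le_iff_le, sub_le_self_iff]

theorem OnLax.wall_le_fst_iff {p s : ℝ × ℝ} (h : OnLax p s) :
    (wall p).1 ≤ s.1 ↔ s.2 ≤ 0 := by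
  rw [h.fst_eq, wall, add_le_add_iff_left, profInv.le_iff_le, le_sub_self_iff]

theorem OnLax.unaffected_of_snd_eq_zero {p s : ℝ × ℝ} (h : OnLax p s) (hs : s.2 = 0) (K : ℝ) :
    Unaffected K p s := .inr (by rwa [h.middle_eq])

theorem OnLax.lt_jump {K : ℝ} {p s : ℝ × ℝ} (h : OnLax p s) (hs : s.2 ≠ 0)
    (hK : Unaffected K p s) : K < jump p s :=
  hK.resolve_right (by rwa [h.middle_eq])

-- A state of the rarefaction close to rest is not at rest but has a small pressure jump.
theorem OnLax.zero_notMem_of_unaffected {K : ℝ} (hK : 0 < K) {p s : ℝ × ℝ} (h : OnLax p s)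
    (hps : s.1 < p.1) (hun : ∀ c ∈ Icc p.2 s.2, Unaffected K p (p.1 + p.2 - c, c)) :
    (0 : ℝ) ∉ Icc p.2 s.2 := by
  intro h₀
  have hcurve {c : ℝ} (hc : p.2 ≤ c) : OnLax p (p.1 + p.2 - c, c) :=
    onLax_of_add_eq (by simp) (by linarith)
  have hlt : p.2 < s.2 := by linarith [h.add_eq hps.le]
  have hrest : jump p (p.1 + p.2 - 0, 0) = 0 :=
    jump_eq_zero_of_middle (by rw [(hcurve h₀.1).middle_eq])
  have hcont : Continuous fun c => jump p (p.1 + p.2 - c, c) :=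
    continuous_jump.comp (f := fun c => (p, (p.1 + p.2 - c, c))) (by fun_prop)
  have hsmall : ∀ᶠ c in 𝓝 (0 : ℝ), jump p (p.1 + p.2 - c, c) < K :=
    hcont.continuousAt.eventually_lt_const (hrest.trans_lt hK)
  have hacc : AccPt (0 : ℝ) (𝓟 (Icc p.2 s.2)) :=
    isPreconnected_Icc.preperfect_of_nontrivial
      ⟨p.2, left_mem_Icc.2 hlt.le, s.2, right_mem_Icc.2 hlt.le, hlt.ne⟩ 0 h₀
  obtain ⟨c, ⟨hc₀, hc⟩, hcK⟩ := ((accPt_iff_frequently.1 hacc).and_eventually hsmall).exists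
  exact hcK.not_gt ((hcurve hc.1).lt_jump hc₀ (hun c hc))

theorem forall_unaffected_to_wall_iff {b : Bool} {K : ℝ} (hK : 0 < K) {p q : ℝ × ℝ} :
    (∀ x, side b x ≤ below 0 → Unaffected K p (closedValve p q (side b x))) ↔
      0 ≤ p.2 ∧ Unaffected K p p := by
  have hwall := onLax_wall p
  have hall : (∀ x, side b x ≤ below 0 → Unaffected K p (closedValve p q (side b x))) ↔
      ∀ x, Unaffected K p (wave p (wall p) (side b x)) := by
    refine forall_congr' fun x => ?_
    by_cases hx : side b x ≤ below 0
    · simp only [hx, true_imp_iff, closedValve_of_le hx]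
    · simp only [hx, false_imp_iff, true_iff,
        hwall.wave_eq_right (OneSided.le_pos_of_not_le_below hx)]
      exact hwall.unaffected_of_snd_eq_zero rfl K
  rw [hall, hwall.forall_wave_iff]
  constructor
  · rintro ⟨hp, -, hrare⟩
    refine ⟨not_lt.1 fun hneg => ?_, hp⟩
    have hlt : (wall p).1 < p.1 := by
      simpa [wall, profInv_of_nonpos hneg.le] using hneg
    exact hwall.zero_notMem_of_unaffected hK hlt (hrare hlt) ⟨hneg.le, le_rfl⟩
  · rintro ⟨hnn, hp⟩
    exact ⟨hp, hwall.unaffected_of_snd_eq_zero rfl K,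
      fun hlt => absurd hlt ((OnLax.refl p).fst_le_wall_iff.2 hnn).not_gt⟩

theorem abs_exp_sub_exp_le {α β α' β' : ℝ} (hα : α' ≤ α) (hαβ : α ≤ β) (hβ : β ≤ β') :
    |Real.exp α - Real.exp β| ≤ |Real.exp α' - Real.exp β'| := by
  have h₁ := Real.exp_le_exp.2 hαβ
  have h₂ := Real.exp_le_exp.2 hα
  have h₃ := Real.exp_le_exp.2 hβ
  rw [abs_of_nonpos (by linarith), abs_of_nonpos (by linarith)]
  linarith

theorem wall_le_wall_of_add_eq {p u : ℝ × ℝ} (h : u.1 + u.2 = p.1 + p.2) (hpu : p.2 ≤ u.2) :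
    (wall u).1 ≤ (wall p).1 := by
  simp only [wall]
  linarith [profInv_sub_le hpu]

theorem wall_reflect_le_wall_reflect_of_add_eq {p u : ℝ × ℝ} (h : u.1 + u.2 = p.1 + p.2)
    (hpu : p.2 ≤ u.2) : (wall (reflect u)).1 ≤ (wall (reflect p)).1 := by
  simp only [wall, reflect]
  linarith [profInv.monotone (neg_le_neg hpu)]

theorem OnLax.lt_jump_rarefaction {K : ℝ} {p q s : ℝ × ℝ} (h₁ : OnLax p s)
    (h₂ : OnLax (reflect q) (reflect s)) (hlt : s.1 < p.1) (h₀ : (0 : ℝ) ∉ Icc p.2 s.2)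
    (hpq : K < jump p q) (hpp : K < jump p p) (hps : K < jump p s) (hsq : K < jump s q) {c : ℝ}
    (hc : c ∈ Icc p.2 s.2) :
    K < jump p (p.1 + p.2 - c, c) ∧ K < jump (p.1 + p.2 - c, c) q := by
  set u : ℝ × ℝ := (p.1 + p.2 - c, c) with hu
  have hup : u.1 + u.2 = p.1 + p.2 := sub_add_cancel _ _
  have hsu : s.1 + s.2 = u.1 + u.2 := (h₁.add_eq hlt.le).trans hup.symm
  rcases lt_or_ge 0 p.2 with hp | hp
  · have hs : 0 ≤ s.2 := hp.le.trans (hc.1.trans hc.2)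
    have hmid : (wall (reflect p)).1 ≤ (wall p).1 :=
      ((OnLax.refl (reflect p)).wall_le_fst_iff.2 (by simpa using hp.le)).trans
        ((OnLax.refl p).fst_le_wall_iff.2 hp.le)
    have hmid' : (wall (reflect q)).1 ≤ (wall s).1 :=
      (h₂.wall_le_fst_iff.2 (by simpa using hs)).trans ((OnLax.refl s).fst_le_wall_iff.2 hs)
    exact ⟨hpp.trans_le (abs_exp_sub_exp_le (wall_reflect_le_wall_reflect_of_add_eq hup hc.1)
        hmid le_rfl),
      hsq.trans_le (abs_exp_sub_exp_le le_rfl hmid' (wall_le_wall_of_add_eq hsu hc.2))⟩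
  · have hs : s.2 < 0 := not_le.1 fun hs => h₀ ⟨hp, hs⟩
    have hmid : (wall p).1 ≤ (wall (reflect s)).1 :=
      (h₁.wall_le_fst_iff.2 hs.le).trans
        ((OnLax.refl (reflect s)).fst_le_wall_iff.2 (by simpa using hs.le))
    have hwall : wall u = wall p := by
      simp only [hu, wall, profInv_of_nonpos hp, profInv_of_nonpos (hc.2.trans hs.le),
        sub_add_cancel]
    constructor
    · rw [jump, abs_sub_comm] at hps ⊢
      exact hps.trans_le (abs_exp_sub_exp_le le_rfl hmid
        (wall_reflect_le_wall_reflect_of_add_eq hsu hc.2))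
    · rwa [jump, hwall]

theorem OnLax.forall_unaffected_wave_iff {b : Bool} {K : ℝ} (hK : 0 < K) {p q s : ℝ × ℝ}
    (h₁ : OnLax p s) (h₂ : OnLax (reflect q) (reflect s)) (hpq : K < jump p q) :
    (∀ x, Unaffected K p (wave p s (side b x)) ∧ Unaffected K (wave p s (side b x)) q) ↔
      Unaffected K p p ∧ Unaffected K p s ∧ Unaffected K s q ∧
        (s.1 < p.1 → (0 : ℝ) ∉ Icc p.2 s.2) := by
  rw [h₁.forall_wave_iff b (P := fun u => Unaffected K p u ∧ Unaffected K u q)]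
  constructor
  · rintro ⟨⟨hpp, -⟩, ⟨hps, hsq⟩, hrare⟩
    exact ⟨hpp, hps, hsq, fun hlt =>
      h₁.zero_notMem_of_unaffected hK hlt fun c hc => (hrare hlt c hc).1⟩
  · rintro ⟨hpp, hps, hsq, hrest⟩
    refine ⟨⟨hpp, .inl hpq⟩, ⟨hps, hsq⟩, fun hlt c hc => ?_⟩
    have hle := h₁.snd_le hlt.le
    have hne {d : ℝ} (hd : d ∈ Icc p.2 s.2) : d ≠ 0 := fun h => hrest hlt (h ▸ hd)
    have hs := hne (right_mem_Icc.2 hle)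
    have hsq' := hsq.resolve_right (by rwa [eq_middle (OnLax.refl s) h₂])
    exact (h₁.lt_jump_rarefaction h₂ hlt (hrest hlt) hpq
      ((OnLax.refl p).lt_jump (hne (left_mem_Icc.2 hle)) hpp) (h₁.lt_jump hs hps) hsq' hc).imp
      .inl .inl

/-- Consistence in logarithmic coordinates, for right-continuous profiles. -/
def Consistent (K : ℝ) (p q : ℝ × ℝ) : Prop :=
  LeftConsistent true K p q ∧ LeftConsistent false K (reflect q) (reflect p)

theorem unaffected_valve_reflect {b : Bool} {K : ℝ} {p q : ℝ × ℝ} (y : ℝ) :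
    Unaffected K (reflect q) (valve K (reflect q) (reflect p) (side b (-y))) ↔
      Unaffected K (valve K p q (side (!b) y)) q := by
  rw [valve_reflect, unaffected_reflect, OneSided.flip_side, neg_neg]

theorem Unaffected.consistent_iff {K : ℝ} {p q : ℝ × ℝ} (h : Unaffected K p q) :
    Consistent K p q ↔ ∀ y, Unaffected K p (valve K p q (above y)) ∧
      Unaffected K (valve K p q (above y)) q := by
  rw [Consistent, h.leftConsistent_iff, (unaffected_reflect.2 h).leftConsistent_iff, forall_and]
  refine and_congr_right' (neg_surjective.forall.trans ?_)
  simp only [unaffected_valve_reflect, Bool.not_false]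

theorem consistent_iff_of_jump_le {K : ℝ} {p q : ℝ × ℝ} (h : jump p q ≤ K) :
    Consistent K p q ↔ (∀ y < 0, Unaffected K p (valve K p q (above y))) ∧
      ∀ y ≥ 0, Unaffected K (valve K p q (above y)) q := by
  rw [Consistent, leftConsistent_iff_of_jump_le h,
    leftConsistent_iff_of_jump_le ((jump_reflect p q).trans_le h),
    neg_surjective.forall (p := fun y => side false y ≤ below 0 → _)]
  simp only [unaffected_valve_reflect, Bool.not_false, OneSided.side_le_side]
  simp [le_iff_lt_or_eq, eq_comm]

theorem consistent_iff_of_jump_le' {K : ℝ} (hK : 0 < K) {p q : ℝ × ℝ} (h : jump p q ≤ K) :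
    Consistent K p q ↔ (0 ≤ p.2 ∧ q.2 ≤ 0) ∧ Unaffected K p p ∧ Unaffected K q q := by
  have h' : jump (reflect q) (reflect p) ≤ K := (jump_reflect p q).trans_le h
  rw [Consistent, leftConsistent_iff_of_jump_le h, leftConsistent_iff_of_jump_le h',
    valve_of_le h, valve_of_le h', forall_unaffected_to_wall_iff hK,
    forall_unaffected_to_wall_iff hK, unaffected_reflect, reflect_snd, neg_nonneg,
    and_and_and_comm]

theorem consistent_iff_of_lt_jump {K : ℝ} (hK : 0 < K) {p q : ℝ × ℝ} (h : K < jump p q) :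
    Consistent K p q ↔
      (Unaffected K p p ∧ Unaffected K q q ∧ Unaffected K p (middle p q) ∧
        Unaffected K (middle p q) q) ∧
      ((middle p q).1 < p.1 → (0 : ℝ) ∉ Icc p.2 (middle p q).2) ∧
      ((middle p q).1 < q.1 → (0 : ℝ) ∉ Icc (middle p q).2 q.2) := by
  have h' : K < jump (reflect q) (reflect p) := h.trans_eq (jump_reflect p q).symm
  have hwave' : (∀ x, Unaffected K p (wave' (middle p q) q (above x)) ∧
      Unaffected K (wave' (middle p q) q (above x)) q) ↔
      ∀ x, Unaffected K (reflect q) (wave (reflect q) (reflect (middle p q)) (below x)) ∧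
        Unaffected K (wave (reflect q) (reflect (middle p q)) (below x)) (reflect p) := by
    rw [neg_surjective.forall]
    refine forall_congr' fun x => ?_
    rw [wave', OneSided.flip_side, neg_neg, Bool.not_true, and_comm, ← unaffected_reflect,
      reflect_reflect, ← unaffected_reflect (p := p), reflect_reflect]
  rw [Unaffected.consistent_iff (.inl h), valve_of_lt h,
    forall_lax_iff p q true (P := fun u => Unaffected K p u ∧ Unaffected K u q), hwave',
    (onLax_middle p q).forall_unaffected_wave_iff hK (onLax_reflect_middle p q) h,
    (onLax_reflect_middle p q).forall_unaffected_wave_iff hK (by simpa using onLax_middle p q) h']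
  simp only [unaffected_reflect, reflect_fst, reflect_snd, mem_Icc, neg_nonneg, neg_nonpos]
  tauto

/-! ### Transfer to the original variables -/

theorem toState_snd_eq_zero_iff {a : ℝ} (ha : 0 < a) {p : ℝ × ℝ} :
    (toState a p).2 = 0 ↔ p.2 = 0 := by
  simp [toState, ha.ne']

/-- The log-density and the velocity in units of `a`; the inverse of `toState a` on `Omega`. -/
def toLog (a : ℝ) (u : State) : ℝ × ℝ := (Real.log u.1, u.2 / (a * u.1))

theorem toState_toLog {a : ℝ} (ha : 0 < a) {u : State} (hu : u ∈ Omega) :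
    toState a (toLog a u) = u := by
  have hpos : 0 < u.1 := hu
  ext
  · exact Real.exp_log hpos
  · simp only [toState, toLog, Real.exp_log hpos]
    field_simp

theorem toLog_toState {a : ℝ} (ha : 0 < a) (p : ℝ × ℝ) : toLog a (toState a p) = p := by
  ext
  · exact Real.log_exp _
  · simp only [toState, toLog]
    field_simp

theorem toState_injective {a : ℝ} (ha : 0 < a) : Function.Injective (toState a) :=
  Function.LeftInverse.injective (toLog_toState ha)

@[fun_prop]
theorem continuous_toState (a : ℝ) : Continuous (toState a) := by unfold toState; fun_prop

theorem continuousAt_toLog {a : ℝ} (ha : 0 < a) {u : State} (hu : u ∈ Omega) :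
    ContinuousAt (toLog a) u := by
  have hpos : 0 < u.1 := hu
  exact (continuousAt_fst.log hpos.ne').prodMk
    (continuousAt_snd.div (continuousAt_const.mul continuousAt_fst) (mul_pos ha hpos).ne')

theorem tilde_toState {a : ℝ} (ha : 0 < a) (p q : ℝ × ℝ) :
    tilde a (toState a p) (toState a q) = toState a (middle p q) := by
  have hex := existsUnique_tilde ha (toState_mem a p) (toState_mem a q)
  have hrho : tildeRho a (toState a p) (toState a q) = Real.exp (middle p q).1 :=
    hex.unique (Classical.epsilon_spec hex.exists) ⟨Real.exp_pos _,
      (FL1_toState_eq_BL2_toState_iff ha).2 ⟨_, onLax_middle p q, onLax_reflect_middle p q⟩⟩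
  rw [tilde, hrho, FL1_toState, ← onLax_middle p q]
  rfl

theorem hat_toState {a : ℝ} (ha : 0 < a) (p : ℝ × ℝ) :
    hat a 0 (toState a p) = toState a (wall p) := by
  obtain ⟨hpos, hzero⟩ : 0 < hatRho a 0 (toState a p) ∧
      FL1 a (hatRho a 0 (toState a p)) (toState a p) = 0 :=
    (Classical.epsilon_spec (exists_hat ha (toState_mem a p))).1
  rw [← Real.exp_log hpos, FL1_toState, toState_snd_eq_zero_iff ha] at hzero
  have hwall : (Real.log (hatRho a 0 (toState a p)), 0) = wall p := eq_wall hzero.symm rfl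
  rw [← hwall, hat, toState.eq_1 a (_, 0), Real.exp_log hpos, mul_zero, mul_zero]

theorem check_toState {a : ℝ} (ha : 0 < a) (q : ℝ × ℝ) :
    check a 0 (toState a q) = toState a (wall (reflect q)) := by
  have hmirror : check a 0 (toState a q) = hat a 0 (reflect (toState a q)) := by
    simp only [check, hat, checkRho, hatRho, BL2_eq_neg_FL1, neg_eq_zero]
  rw [hmirror, reflect_toState, hat_toState ha]

theorem closedJump_toState {a : ℝ} (ha : 0 < a) (p q : ℝ × ℝ) :
    closedJump a (toState a p) (toState a q) = a ^ 2 * jump p q := by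
  rw [closedJump, hat_toState ha, check_toState ha, pressure, pressure, ← mul_sub, abs_mul,
    abs_of_pos (pow_pos ha 2)]
  rfl

theorem OnLax.shockSpeed_toState {a : ℝ} {p s : ℝ × ℝ} (h : OnLax p s) (hps : p.1 < s.1) :
    shockSpeed (toState a p) (toState a s) = a * jumpSpeed p s.1 := by
  set E := Real.exp ((s.1 - p.1) / 2) with hE
  have hE₁ : 1 < E := Real.one_lt_exp_iff.2 (by linarith)
  have hs₁ : Real.exp s.1 = Real.exp p.1 * E ^ 2 := by
    rw [hE, ← Real.exp_nat_mul, ← Real.exp_add]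
    congr 1
    push_cast
    ring
  have hs₂ : s.2 = p.2 - (E - E⁻¹) := by
    rw [hE, ← Real.exp_neg, ← prof_of_pos (sub_pos.2 hps)]
    exact h
  have hden : Real.exp p.1 - Real.exp p.1 * E ^ 2 ≠ 0 := by
    have := lt_mul_of_one_lt_right (Real.exp_pos p.1) (one_lt_pow₀ hE₁ two_ne_zero)
    linarith
  rw [shockSpeed, jumpSpeed, ← hE, div_eq_iff (by simpa only [toState, hs₁] using hden)]
  simp only [toState, hs₁, hs₂]
  field_simp
  ring

theorem toState_fst_lt_iff {a : ℝ} {p s : ℝ × ℝ} :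
    (toState a p).1 < (toState a s).1 ↔ p.1 < s.1 := Real.exp_lt_exp

theorem shockSpeed_reflect (u u' : State) :
    shockSpeed (reflect u') (reflect u) = -shockSpeed u u' := by
  rw [shockSpeed, shockSpeed, reflect_fst, reflect_fst, reflect_snd, reflect_snd, ← neg_sub u.1,
    div_neg, neg_sub_neg]

theorem lam1_toState (a : ℝ) (p : ℝ × ℝ) : lam1 a (toState a p) = a * (p.2 - 1) := by
  rw [lam1, vel_toState]; ring

theorem lam2_toState (a : ℝ) (p : ℝ × ℝ) : lam2 a (toState a p) = a * (p.2 + 1) := by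
  rw [lam2, vel_toState]; ring

theorem OnLax.wave1_toState {a : ℝ} (ha : 0 < a) {p s : ℝ × ℝ} (h : OnLax p s) (x : ℝ) :
    wave1 a (toState a p) (toState a s) (a * x) = toState a (wave p s (above x)) := by
  rcases lt_or_ge p.1 s.1 with hps | hps
  · rw [wave1, wave_of_lt hps, if_pos (toState_fst_lt_iff.2 hps), h.shockSpeed_toState hps,
      apply_ite (toState a)]
    simp only [mul_lt_mul_iff_right₀ ha, OneSided.above_le_below]
  · rw [wave1, wave_of_le hps, if_neg (mt toState_fst_lt_iff.1 hps.not_gt), lam1_toState,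
      lam1_toState, OneSided.pos_side]
    simp only [mul_lt_mul_iff_right₀ ha]
    have hadd := h.add_eq hps
    have hsnd := h.snd_le hps
    split_ifs with hp hs
    · rw [max_eq_left (min_le_of_left_le (by linarith)), add_sub_cancel_right]
    · have hexp : (a * (p.2 - 1) - a * x) / a = p.2 - (x + 1) := by field_simp; ring
      rw [min_eq_left (by linarith), max_eq_right (by linarith), toState_fst, toState, hexp,
        ← Real.exp_add, ← add_sub_assoc, mul_add_one]
    · rw [min_eq_right (by linarith), max_eq_right hsnd, ← hadd, add_sub_cancel_right]

theorem OnLax.wave2_toState {a : ℝ} (ha : 0 < a) {s q : ℝ × ℝ}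
    (h : OnLax (reflect q) (reflect s)) (x : ℝ) :
    wave2 a (toState a s) (toState a q) (a * x) = toState a (wave' s q (above x)) := by
  rcases lt_or_ge q.1 s.1 with hqs | hqs
  · have hspeed : shockSpeed (toState a s) (toState a q) = a * -jumpSpeed (reflect q) s.1 := by
      rw [← neg_neg (shockSpeed _ _), ← shockSpeed_reflect, reflect_toState, reflect_toState,
        h.shockSpeed_toState hqs, mul_neg, reflect_fst]
    have hside : below (-x) ≤ below (jumpSpeed (reflect q) s.1) ↔
        ¬x < -jumpSpeed (reflect q) s.1 := by
      simp [OneSided.side_le_side, ← le_iff_lt_or_eq, neg_le]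
    rw [wave2, if_pos (toState_fst_lt_iff.2 hqs), hspeed, wave',
      wave_of_lt (p := reflect q) (s := reflect s) hqs]
    simp only [OneSided.flip_side, Bool.not_true, hside, reflect_fst, mul_lt_mul_iff_right₀ ha,
      ite_not, apply_ite reflect, reflect_reflect, apply_ite (toState a)]
  · rw [wave2, if_neg (mt toState_fst_lt_iff.1 hqs.not_gt), lam2_toState, lam2_toState, wave',
      wave_of_le (p := reflect q) (s := reflect s) hqs, OneSided.pos_flip, OneSided.pos_side]
    simp only [mul_lt_mul_iff_right₀ ha, reflect_fst, reflect_snd]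
    have hadd : s.1 - s.2 = q.1 - q.2 := h.add_eq hqs
    have hsnd : -q.2 ≤ -s.2 := h.snd_le hqs
    split_ifs with hs hq
    · rw [min_eq_right (by linarith), max_eq_right hsnd, reflect, ← sub_eq_add_neg, ← hadd]
      simp
    · have hexp : (a * x - a * (s.2 + 1)) / a = x - 1 - s.2 := by field_simp; ring
      have hfst : s.1 + (x - 1 - s.2) = q.1 + -q.2 - (-x + 1) := by linarith
      have hvel : a * x - a = a * -(-x + 1) := by ring
      rw [min_eq_left (by linarith), max_eq_right (by linarith), toState_fst, reflect, toState,
        hexp, ← Real.exp_add, hfst, hvel]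
    · rw [max_eq_left (min_le_of_left_le (by linarith)), reflect]
      simp

theorem RSp_toState {a : ℝ} (ha : 0 < a) (p q : ℝ × ℝ) (ξ : ℝ) :
    RSp a (toState a p) (toState a q) ξ = toState a (lax p q (above (ξ / a))) := by
  obtain ⟨x, rfl⟩ : ∃ x, ξ = a * x := ⟨ξ / a, (mul_div_cancel₀ _ ha.ne').symm⟩
  rw [mul_div_cancel_left₀ _ ha.ne', RSp, tilde_toState ha, vel_toState, lax,
    (onLax_middle p q).wave1_toState ha, (onLax_reflect_middle p q).wave2_toState ha,
    apply_ite (toState a)]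
  simp only [mul_lt_mul_iff_right₀ ha, OneSided.above_le_below]

theorem closedJump_le_iff {a : ℝ} (ha : 0 < a) {M : ℝ} {p q : ℝ × ℝ} :
    closedJump a (toState a p) (toState a q) ≤ M ↔ jump p q ≤ M / a ^ 2 := by
  rw [closedJump_toState ha, le_div_iff₀' (pow_pos ha 2)]

theorem RSv_toState {a : ℝ} (ha : 0 < a) (M : ℝ) (p q : ℝ × ℝ) (ξ : ℝ) :
    RSv a M (toState a p) (toState a q) ξ =
      toState a (valve (M / a ^ 2) p q (above (ξ / a))) := by
  have hneg : ξ < 0 ↔ ξ / a < 0 := by rw [div_lt_iff₀ ha, zero_mul]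
  have hcheck : lax (wall (reflect q)) q = wave' (wall (reflect q)) q :=
    OnLax.lax_eq' (by simpa using onLax_wall (reflect q))
  simp only [RSv, hat_toState ha, check_toState ha, RSp_toState ha, (onLax_wall p).lax_eq, hcheck,
    valve, closedValve, OneSided.above_le_below, closedJump_le_iff ha, hneg, apply_ite (toState a)]

theorem forall_toState_eq_iff {a : ℝ} (ha : 0 < a) {f g : ℝ → ℝ × ℝ} :
    (∀ ξ, toState a (f (ξ / a)) = toState a (g (ξ / a))) ↔ ∀ x, f x = g x := by
  simp only [(toState_injective ha).eq_iff]
  exact ⟨fun h x => by simpa [ha.ne'] using h (a * x), fun h ξ => h _⟩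

theorem mem_domV_toState (a : ℝ) (p q : ℝ × ℝ) : (toState a p, toState a q) ∈ domV :=
  ⟨toState_mem a p, toState_mem a q⟩

theorem eq_of_forall_toState_mem_iff {a : ℝ} (ha : 0 < a) {S T : Set (State × State)}
    (hS : S ⊆ domV) (hT : T ⊆ domV)
    (h : ∀ p q, (toState a p, toState a q) ∈ S ↔ (toState a p, toState a q) ∈ T) : S = T := by
  have hdom : ∀ d ∈ domV, d ∈ S ↔ d ∈ T := fun d hd => by
    simpa only [toState_toLog ha hd.1, toState_toLog ha hd.2] using h (toLog a d.1) (toLog a d.2)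
  exact Subset.antisymm (fun d hd => (hdom d (hS hd)).1 hd) fun d hd => (hdom d (hT hd)).2 hd

section Domains

variable {a M : ℝ} {p q : ℝ × ℝ} (ha : 0 < a)
include ha

theorem mem_setA_iff : (toState a p, toState a q) ∈ setA a M ↔ jump p q ≤ M / a ^ 2 := by
  simp only [setA, mem_ofPred_eq, mem_domV_toState, true_and, closedJump_le_iff ha]

theorem mem_setO_iff : (toState a p, toState a q) ∈ setO a M ↔ M / a ^ 2 < jump p q := by
  simp only [setO, mem_ofPred_eq, mem_domV_toState, true_and, ← not_le, closedJump_le_iff ha]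

theorem mem_setAI_iff : (toState a p, toState a q) ∈ setAI a M ↔ ¬Unaffected (M / a ^ 2) p q := by
  have hall : (∀ ξ, RSv a M (toState a p) (toState a q) ξ = RSp a (toState a p) (toState a q) ξ) ↔
      Unaffected (M / a ^ 2) p q := by
    simp only [RSv_toState ha, RSp_toState ha]
    rw [unaffected_iff true]
    exact forall_toState_eq_iff ha (f := fun x => valve (M / a ^ 2) p q (above x))
      (g := fun x => lax p q (above x))
  simp only [setAI, setAN, Set.mem_sdiff, mem_ofPred_eq, mem_setA_iff ha, hall]
  simp only [Unaffected]
  grind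

theorem mem_setAIc_iff : (toState a p, toState a q) ∈ setAIc a M ↔ Unaffected (M / a ^ 2) p q := by
  simp only [setAIc, Set.mem_sdiff, mem_domV_toState, true_and, mem_setAI_iff ha, not_not]

end Domains

/-! ### Traces and coherence -/

namespace OneSided

/-- The order topology makes `OneSided` the split line, on which a function is continuous if and
only if it has one-sided limits and takes them as values. -/
instance : TopologicalSpace OneSided := Preorder.topology OneSided

instance : OrderTopology OneSided := ⟨rfl⟩

theorem continuous_pos : Continuous pos :=
  monotone_pos.continuous_of_surjective fun x => ⟨above x, rfl⟩

theorem continuous_flip : Continuous flip :=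
  let e : OneSided ≃o OneSidedᵒᵈ :=
    { toFun := OrderDual.toDual ∘ flip
      invFun := flip ∘ OrderDual.ofDual
      left_inv := flip_flip
      right_inv := flip_flip
      map_rel_iff' := fun {ξ η} =>
        ⟨fun h => by simpa only [flip_flip] using antitone_flip (show η.flip ≤ ξ.flip from h),
          fun h => antitone_flip h⟩ }
  e.continuous

theorem isClopen_Iic_below (x : ℝ) : IsClopen (Iic (below x)) := by
  have hIio : Iic (below x) = Iio (above x) := by
    ext ξ
    rw [mem_Iic, mem_Iio, ← not_le, above_le_iff_not_le_below, not_not]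
  exact ⟨isClosed_Iic, hIio ▸ isOpen_Iio⟩

theorem tendsto_above_nhdsLT (x : ℝ) : Tendsto above (𝓝[<] x) (𝓝 (below x)) := by
  refine tendsto_order.2 ⟨fun ξ hξ => ?_, fun ξ hξ => ?_⟩
  · filter_upwards [Ioo_mem_nhdsLT (lt_below_iff.1 hξ)] with y hy
    exact (lt_below_iff.2 hy.1).trans_le (side_le_side.2 (by simp))
  · filter_upwards [self_mem_nhdsWithin] with y hy
    exact (above_le_below.2 hy).trans_lt hξ

theorem tendsto_above_nhdsGT (x : ℝ) : Tendsto above (𝓝[>] x) (𝓝 (above x)) := by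
  refine tendsto_order.2 ⟨fun ξ hξ => ?_, fun ξ hξ => ?_⟩
  · filter_upwards [self_mem_nhdsWithin] with y hy
    exact hξ.trans (above_lt_iff.2 hy)
  · filter_upwards [Ioo_mem_nhdsGT (above_lt_iff.1 hξ)] with y hy
    exact above_lt_iff.2 hy.2

end OneSided

theorem continuous_ite_le_below {X : Type*} [TopologicalSpace X] {f g : OneSided → X} (x : ℝ)
    (hf : Continuous f) (hg : Continuous g) :
    Continuous fun ξ => if ξ ≤ below x then f ξ else g ξ :=
  hf.if (fun ξ hξ => by
    rw [show {ξ | ξ ≤ below x} = Iic (below x) from rfl,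
      (OneSided.isClopen_Iic_below x).frontier_eq] at hξ
    exact hξ.elim) hg

theorem continuous_wave (p s : ℝ × ℝ) : Continuous (wave p s) := by
  rcases lt_or_ge p.1 s.1 with hps | hps
  · rw [funext (wave_of_lt hps)]
    exact continuous_ite_le_below _ continuous_const continuous_const
  · rw [funext (wave_of_le hps)]
    have := OneSided.continuous_pos
    fun_prop

theorem continuous_wave' (s q : ℝ × ℝ) : Continuous (wave' s q) :=
  continuous_reflect.comp ((continuous_wave _ _).comp OneSided.continuous_flip)

theorem continuous_lax (p q : ℝ × ℝ) : Continuous (lax p q) :=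
  continuous_ite_le_below _ (continuous_wave _ _) (continuous_wave' _ _)

theorem continuous_closedValve (p q : ℝ × ℝ) : Continuous (closedValve p q) :=
  continuous_ite_le_below _ (continuous_wave _ _) (continuous_wave' _ _)

theorem continuous_valve (K : ℝ) (p q : ℝ × ℝ) : Continuous (valve K p q) :=
  continuous_if_const _ (fun _ => continuous_closedValve p q) fun _ => continuous_lax p q

theorem tendsto_toState_nhdsLT {a : ℝ} (ha : 0 < a) {f : OneSided → ℝ × ℝ} (hf : Continuous f)
    (x : ℝ) : Tendsto (fun ξ => toState a (f (above (ξ / a)))) (𝓝[<] x)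
      (𝓝 (toState a (f (below (x / a))))) := by
  have hdiv : Tendsto (fun ξ => ξ / a) (𝓝[<] x) (𝓝[<] (x / a)) :=
    (continuous_id.div_const a).continuousWithinAt.tendsto_nhdsWithin fun _ hξ =>
      div_lt_div_of_pos_right hξ ha
  exact (((continuous_toState a).comp hf).tendsto _).comp
    ((OneSided.tendsto_above_nhdsLT _).comp hdiv)

theorem tendsto_toState_nhdsGT {a : ℝ} (ha : 0 < a) {f : OneSided → ℝ × ℝ} (hf : Continuous f)
    (x : ℝ) : Tendsto (fun ξ => toState a (f (above (ξ / a)))) (𝓝[>] x)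
      (𝓝 (toState a (f (above (x / a))))) := by
  have hdiv : Tendsto (fun ξ => ξ / a) (𝓝[>] x) (𝓝[>] (x / a)) :=
    (continuous_id.div_const a).continuousWithinAt.tendsto_nhdsWithin fun _ hξ =>
      div_lt_div_of_pos_right hξ ha
  exact (((continuous_toState a).comp hf).tendsto _).comp
    ((OneSided.tendsto_above_nhdsGT _).comp hdiv)

theorem leftLim_toState {a : ℝ} (ha : 0 < a) {f : OneSided → ℝ × ℝ} (hf : Continuous f) :
    Function.leftLim (fun ξ => toState a (f (above (ξ / a)))) 0 = toState a (f (below 0)) := by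
  simpa only [zero_div] using leftLim_eq_of_tendsto (tendsto_toState_nhdsLT ha hf 0)

theorem rightLim_toState {a : ℝ} (ha : 0 < a) {f : OneSided → ℝ × ℝ} (hf : Continuous f) :
    Function.rightLim (fun ξ => toState a (f (above (ξ / a)))) 0 = toState a (f (above 0)) := by
  simpa only [zero_div] using rightLim_eq_of_tendsto (tendsto_toState_nhdsGT ha hf 0)

theorem coherenceDomain_RSv {a : ℝ} (ha : 0 < a) (M : ℝ) :
    coherenceDomain domV (RSv a M) = setA a M ∪ setOO a M := by
  refine eq_of_forall_toState_mem_iff ha (fun d hd => hd.1)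
    (union_subset (fun d hd => hd.1) fun d hd => hd.1.1) fun p q => ?_
  have hvalve := funext (RSv_toState ha M p q)
  have hlax := funext (RSp_toState ha p q)
  have hcoherent : (toState a p, toState a q) ∈ coherenceDomain domV (RSv a M) ↔
      (M / a ^ 2 < jump p q → M / a ^ 2 < jump (lax p q (below 0)) (lax p q (above 0))) := by
    rw [← valve_coherent_iff, ← forall_toState_eq_iff ha]
    simp only [coherenceDomain, mem_ofPred_eq, mem_domV_toState, true_and, hvalve,
      leftLim_toState ha (continuous_valve _ p q), rightLim_toState ha (continuous_valve _ p q),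
      RSv_toState ha, apply_ite (toState a), div_lt_iff₀ ha, zero_mul]
  simp only [hcoherent, mem_union, setOO, mem_ofPred_eq, mem_setA_iff ha, mem_setO_iff ha, hlax,
    leftLim_toState ha (continuous_lax p q), rightLim_toState ha (continuous_lax p q)]
  grind

/-! ### Consistence -/

theorem OneSided.apply_min_above {α : Type*} (f : OneSided → α) (x y : ℝ) :
    f (min (above x) (above y)) = if x < y then f (above x) else f (above y) := by
  rcases lt_or_ge x y with h | h
  · rw [if_pos h, min_eq_left (side_le_side.2 (.inl h))]
  · rw [if_neg h.not_gt, min_eq_right (side_le_side.2 (by simpa using h.lt_or_eq))]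

theorem OneSided.apply_max_above {α : Type*} (f : OneSided → α) (x y : ℝ) :
    f (max (above x) (above y)) = if x < y then f (above y) else f (above x) := by
  rcases lt_or_ge x y with h | h
  · rw [if_pos h, max_eq_right (side_le_side.2 (.inl h))]
  · rw [if_neg h.not_gt, max_eq_left (side_le_side.2 (by simpa using h.lt_or_eq))]

theorem consistentAt_iff {a M : ℝ} (ha : 0 < a) {p q : ℝ × ℝ} :
    ConsistentAt domV (RSv a M) (toState a p) (toState a q) ↔ Consistent (M / a ^ 2) p q := by
  set K := M / a ^ 2 with hK
  have hscale : Function.Surjective fun ξ : ℝ => ξ / a := fun x => ⟨a * x, by field_simp⟩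
  have hleft : LeftConsistent true K p q ↔ ∀ y x, valve K p (valve K p q (above y)) (above x) =
      if x < y then valve K p q (above x) else valve K p q (above y) := by
    simp only [LeftConsistent, OneSided.apply_min_above]
    exact forall_comm
  have hright : LeftConsistent false K (reflect q) (reflect p) ↔
      ∀ y x, valve K (valve K p q (above y)) q (above x) =
        if x < y then valve K p q (above y) else valve K p q (above x) := by
    rw [← Bool.not_true, leftConsistent_reflect]
    simp only [OneSided.apply_max_above]
    exact forall_comm
  rw [Consistent, hleft, hright, ← forall_and, hscale.forall, ConsistentAt]
  refine forall_congr' fun ξo => ?_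
  have hite : ∀ ξ (u v : State),
      (if ξ < ξo then u else v) = if ξ / a < ξo / a then u else v := fun _ _ _ =>
    if_congr (div_lt_div_iff_of_pos_right ha).symm rfl rfl
  simp only [RSv_toState ha, mem_domV_toState, true_and, hite, ← apply_ite (toState a),
    (toState_injective ha).eq_iff, ← hK]
  refine ⟨fun ⟨⟨h₁, h₂⟩, _⟩ => ⟨fun x => ?_, fun x => ?_⟩,
    fun ⟨h₁, h₂⟩ => ⟨⟨fun _ => h₁ _, fun _ => h₂ _⟩, fun ξ => ?_⟩⟩
  · simpa only [mul_div_cancel_left₀ x ha.ne'] using h₁ (a * x)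
  · simpa only [mul_div_cancel_left₀ x ha.ne'] using h₂ (a * x)
  · rw [h₁, h₂]
    split_ifs <;> rfl

theorem mem_consistenceDomain_iff {a M : ℝ} (ha : 0 < a) {p q : ℝ × ℝ} :
    (toState a p, toState a q) ∈ consistenceDomain domV (RSv a M) ↔
      Consistent (M / a ^ 2) p q := by
  simp only [consistenceDomain, mem_ofPred_eq, mem_domV_toState, true_and, consistentAt_iff ha]

theorem consistenceDomain_RSv_eq_CN1_union_CN2 {a : ℝ} (ha : 0 < a) (M : ℝ) :
    consistenceDomain domV (RSv a M) = setCN1 a M ∪ setCN2 a M := by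
  refine eq_of_forall_toState_mem_iff ha (fun d hd => hd.1)
    (union_subset (fun d hd => hd.1.1.1) fun d hd => hd.1.1) fun p q => ?_
  have hscale : Function.Surjective fun ξ : ℝ => ξ / a := fun x => ⟨a * x, by field_simp⟩
  simp only [mem_consistenceDomain_iff ha, mem_union, setCN1, setCN2, mem_ofPred_eq,
    mem_setAI_iff ha, mem_setAIc_iff ha, RSv_toState ha]
  by_cases h : Unaffected (M / a ^ 2) p q
  · simp only [h, not_true, false_and, false_or, true_and, h.consistent_iff]
    exact hscale.forall
  · simp only [h, not_false_eq_true, false_and, or_false, true_and,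
      consistent_iff_of_jump_le (not_lt.1 fun hlt => h (.inl hlt))]
    refine ⟨fun ⟨h₁, h₂⟩ _ _ hm hp =>
      ⟨h₁ _ (div_neg_of_neg_of_pos hm ha), h₂ _ (div_nonneg hp ha.le)⟩,
      fun H => ⟨fun y hy => ?_, fun y hy => ?_⟩⟩
    · simpa only [mul_div_cancel_left₀ y ha.ne'] using
        (H (a * y) 0 (mul_neg_of_pos_of_neg ha hy) le_rfl).1
    · simpa only [mul_div_cancel_left₀ y ha.ne'] using
        (H (-1) (a * y) neg_one_lt_zero (mul_nonneg ha.le hy)).2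

theorem nonzeroAlongRarefactions_iff {a : ℝ} (ha : 0 < a) {p q : ℝ × ℝ} :
    NonzeroAlongRarefactions a (toState a p) (toState a q) ↔
      ((middle p q).1 < p.1 → (0 : ℝ) ∉ Icc p.2 (middle p q).2) ∧
        ((middle p q).1 < q.1 → (0 : ℝ) ∉ Icc (middle p q).2 q.2) := by
  have hsurj₁ : Function.Surjective fun c : ℝ => a * (c - 1) :=
    (mul_left_surjective₀ ha.ne').comp (Equiv.subRight (1 : ℝ)).surjective
  have hsurj₂ : Function.Surjective fun c : ℝ => a * (c + 1) :=
    (mul_left_surjective₀ ha.ne').comp (Equiv.addRight (1 : ℝ)).surjective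
  have hIcc : ∀ l r : ℝ, (0 : ℝ) ∉ Icc l r ↔ ∀ c, l ≤ c ∧ c ≤ r → c ≠ 0 := fun l r =>
    ⟨fun h c hc hc₀ => h (hc₀ ▸ hc), fun h h₀ => h 0 h₀ rfl⟩
  have hlam₁ : ∀ c r, a * (c - 1) ≤ a * (r - 1) ↔ c ≤ r := by simp [ha]
  have hlam₂ : ∀ c r, a * (c + 1) ≤ a * (r + 1) ↔ c ≤ r := by simp [ha]
  rw [NonzeroAlongRarefactions, tilde_toState ha, hIcc, hIcc]
  simp only [toState_fst_lt_iff, lam1_toState, lam2_toState, RSp_toState ha, ne_eq,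
    toState_snd_eq_zero_iff ha, mem_Icc]
  refine and_congr
    (imp_congr_right fun hlt => hsurj₁.forall.trans (forall_congr' fun c => ?_))
    (imp_congr_right fun hlt => hsurj₂.forall.trans (forall_congr' fun c => ?_)) <;>
    simp only [hlam₁, hlam₂, mul_div_cancel_left₀ _ ha.ne'] <;>
    refine imp_congr_right fun hc => ?_
  · have hsnd : (lax p q (above (c - 1))).2 = c := by
      rw [lax_of_le (OneSided.above_le_below.2 (by linarith)), wave_of_le hlt.le,
        OneSided.pos_side, sub_add_cancel, min_eq_left hc.2, max_eq_right hc.1]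
    rw [hsnd]
  · have hsnd : (lax p q (above (c + 1))).2 = c := by
      rw [lax_of_not_le (by rw [OneSided.above_le_below]; linarith), wave',
        wave_of_le (p := reflect q) (s := reflect (middle p q)) hlt.le]
      simp [hc.1, hc.2]
    rw [hsnd]

theorem consistenceDomain_RSv_eq_CNO_union_CNA {a M : ℝ} (ha : 0 < a) (hM : 0 < M) :
    consistenceDomain domV (RSv a M) = setCNO a M ∪ setCNA a M := by
  refine eq_of_forall_toState_mem_iff ha (fun d hd => hd.1)
    (union_subset (fun d hd => hd.1.1) fun d hd => hd.1.1) fun p q => ?_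
  have hK : 0 < M / a ^ 2 := by positivity
  simp only [mem_consistenceDomain_iff ha, mem_union, setCNO, setCNA, mem_ofPred_eq,
    mem_setA_iff ha, mem_setO_iff ha, mem_setAIc_iff ha, tilde_toState ha,
    nonzeroAlongRarefactions_iff ha]
  rcases le_or_gt (jump p q) (M / a ^ 2) with h | h
  · have hp : 0 ≤ (toState a p).2 ↔ 0 ≤ p.2 := by
      rw [toState, mul_nonneg_iff_of_pos_left (Real.exp_pos _), mul_nonneg_iff_of_pos_left ha]
    have hq : (toState a q).2 ≤ 0 ↔ q.2 ≤ 0 := by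
      rw [toState, ← not_lt, mul_pos_iff_of_pos_left (Real.exp_pos _), mul_pos_iff_of_pos_left ha,
        not_lt]
    simp only [h, h.not_gt, false_and, false_or, true_and, consistent_iff_of_jump_le' hK h, hp, hq]
  · simp only [h, h.not_ge, false_and, or_false, true_and, consistent_iff_of_lt_jump hK h]

/-! ### Invariant domains -/

/-- The set `I_{u₀}` in logarithmic coordinates, where `r` is the log-density of `u₀`. -/
def logRegion (r : ℝ) : Set (ℝ × ℝ) := {p | p.1 + p.2 ≤ r ∧ p.1 - p.2 ≤ r}

theorem reflect_mem_logRegion {r : ℝ} {p : ℝ × ℝ} : reflect p ∈ logRegion r ↔ p ∈ logRegion r := by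
  simp only [logRegion, mem_ofPred_eq, reflect_fst, reflect_snd, ← sub_eq_add_neg, sub_neg_eq_add,
    and_comm]

theorem OnLax.fst_add_snd_le {p s : ℝ × ℝ} (h : OnLax p s) : s.1 + s.2 ≤ p.1 + p.2 := by
  have := le_prof (s.1 - p.1)
  rw [OnLax] at h
  linarith

theorem wall_mem_logRegion {r : ℝ} {p : ℝ × ℝ} (hp : p ∈ logRegion r) : wall p ∈ logRegion r := by
  have hle := (onLax_wall p).fst_add_snd_le.trans hp.1
  exact ⟨hle, by simpa [wall_snd] using hle⟩

theorem middle_mem_logRegion {r : ℝ} {p q : ℝ × ℝ} (hp : p ∈ logRegion r)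
    (hq : q ∈ logRegion r) : middle p q ∈ logRegion r := by
  refine ⟨(onLax_middle p q).fst_add_snd_le.trans hp.1, ?_⟩
  have h := (onLax_reflect_middle p q).fst_add_snd_le.trans (reflect_mem_logRegion.2 hq).1
  simpa only [reflect_fst, reflect_snd, ← sub_eq_add_neg] using h

theorem OnLax.wave_mem_logRegion {r : ℝ} {p s : ℝ × ℝ} (h : OnLax p s) (hp : p ∈ logRegion r)
    (hs : s ∈ logRegion r) (ξ : OneSided) : wave p s ξ ∈ logRegion r := by
  revert ξ
  rw [OneSided.forall_iff (P := fun ξ => wave p s ξ ∈ logRegion r)]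
  refine fun b => (h.forall_wave_iff b).2 ⟨hp, hs, fun _ c hc => ?_⟩
  have := hp.2
  exact ⟨by simpa using hp.1, by simp only; linarith [hc.1]⟩

theorem OnLax.wave'_mem_logRegion {r : ℝ} {s q : ℝ × ℝ} (h : OnLax (reflect q) (reflect s))
    (hs : s ∈ logRegion r) (hq : q ∈ logRegion r) (ξ : OneSided) : wave' s q ξ ∈ logRegion r :=
  reflect_mem_logRegion.2 <|
    h.wave_mem_logRegion (reflect_mem_logRegion.2 hq) (reflect_mem_logRegion.2 hs) _

theorem valve_mem_logRegion {K r : ℝ} {p q : ℝ × ℝ} (hp : p ∈ logRegion r)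
    (hq : q ∈ logRegion r) (ξ : OneSided) : valve K p q ξ ∈ logRegion r := by
  have hm := middle_mem_logRegion hp hq
  have hw := wall_mem_logRegion (reflect_mem_logRegion.2 hq)
  rw [valve, closedValve, lax]
  split_ifs
  · exact (onLax_wall p).wave_mem_logRegion hp (wall_mem_logRegion hp) ξ
  · exact OnLax.wave'_mem_logRegion (by simpa using onLax_wall (reflect q)) hw hq ξ
  · exact (onLax_middle p q).wave_mem_logRegion hp hm ξ
  · exact (onLax_reflect_middle p q).wave'_mem_logRegion hm hq ξ

theorem toState_mem_invRegion_iff {a : ℝ} (ha : 0 < a) {u₀ : State} (h₀ : u₀.2 = 0)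
    {p : ℝ × ℝ} : toState a p ∈ invRegion a u₀ ↔ p ∈ logRegion (Real.log u₀.1) := by
  have hfst : Real.log (toState a p).1 = p.1 := Real.log_exp _
  have hsnd : (toState a p).2 / (a * (toState a p).1) = p.2 :=
    congrArg Prod.snd (toLog_toState ha p)
  simp only [invRegion, mem_ofPred_eq, toState_mem, true_and, invZ, invW, hsnd, hfst, h₀,
    zero_div, logRegion]
  constructor <;> rintro ⟨h₁, h₂⟩ <;> constructor <;> linarith

theorem isInvariantDomain_invRegion {a : ℝ} (ha : 0 < a) (M : ℝ) {u₀ : State} (h₀ : u₀.2 = 0) :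
    IsInvariantDomain domV (RSv a M) (invRegion a u₀) := by
  refine ⟨fun u hu => hu.1, fun d hd => ⟨hd.1.1, hd.2.1⟩, fun ul hl ur hr ξ => ?_⟩
  obtain ⟨p, rfl⟩ : ∃ p, toState a p = ul := ⟨_, toState_toLog ha hl.1⟩
  obtain ⟨q, rfl⟩ : ∃ q, toState a q = ur := ⟨_, toState_toLog ha hr.1⟩
  rw [toState_mem_invRegion_iff ha h₀] at hl hr
  rw [RSv_toState ha, toState_mem_invRegion_iff ha h₀]
  exact valve_mem_logRegion hl hr _

/-! ### Continuous dependence on the data -/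

theorem continuous_zero_of_strictMono {X : Type*} [TopologicalSpace X] {F : X → ℝ → ℝ} {z : X → ℝ}
    (hF : ∀ t, Continuous fun x => F x t) (hmono : ∀ x, StrictMono (F x))
    (hz : ∀ x, F x (z x) = 0) : Continuous z := by
  refine continuous_iff_continuousAt.2 fun x => tendsto_order.2 ⟨fun t ht => ?_, fun t ht => ?_⟩
  · filter_upwards [(hF t).continuousAt.eventually_lt_const (hz x ▸ hmono x ht)] with y hy
    exact (hmono y).lt_iff_lt.1 (hy.trans_eq (hz y).symm)
  · filter_upwards [(hF t).continuousAt.eventually_const_lt (hz x ▸ hmono x ht)] with y hy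
    exact (hmono y).lt_iff_lt.1 ((hz y).trans_lt hy)

theorem continuous_middle : Continuous fun d : (ℝ × ℝ) × (ℝ × ℝ) => middle d.1 d.2 := by
  have hprof := prof_continuous
  have hfst : Continuous fun d : (ℝ × ℝ) × (ℝ × ℝ) => (middle d.1 d.2).1 := by
    refine continuous_zero_of_strictMono
      (F := fun d t => prof (t - d.1.1) + prof (t - d.2.1) - (d.1.2 - d.2.2))
      (fun t => by fun_prop) (fun d s t hst => ?_) fun d => ?_
    · exact sub_lt_sub_right (add_lt_add (prof_strictMono (sub_lt_sub_right hst _))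
        (prof_strictMono (sub_lt_sub_right hst _))) _
    · have h₁ := onLax_middle d.1 d.2
      have h₂ := onLax_reflect_middle d.1 d.2
      simp only [OnLax, reflect_fst, reflect_snd] at h₁ h₂
      linarith
  refine hfst.prodMk ?_
  have hsnd : ∀ d : (ℝ × ℝ) × (ℝ × ℝ),
      (middle d.1 d.2).2 = d.1.2 - prof ((middle d.1 d.2).1 - d.1.1) := fun d => onLax_middle _ _
  exact (by fun_prop : Continuous _).congr fun d => (hsnd d).symm

theorem tendsto_floor_mul_add_one_div (x : ℝ) :
    Tendsto (fun n : ℕ => ((⌊x * (n + 1)⌋ : ℝ) + 1) / (n + 1)) atTop (𝓝[>] x) := by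
  have hpos : ∀ n : ℕ, (0 : ℝ) < n + 1 := fun n => n.cast_add_one_pos
  have hlower : ∀ n : ℕ, x < ((⌊x * (n + 1)⌋ : ℝ) + 1) / (n + 1) := fun n =>
    (lt_div_iff₀ (hpos n)).2 (Int.lt_floor_add_one _)
  have hupper : ∀ n : ℕ, ((⌊x * (n + 1)⌋ : ℝ) + 1) / (n + 1) ≤ x + 1 / (n + 1) := fun n => by
    rw [div_le_iff₀ (hpos n), add_mul, one_div_mul_cancel (hpos n).ne']
    gcongr
    exact Int.floor_le _
  exact tendsto_nhdsWithin_iff.2 ⟨tendsto_of_tendsto_of_tendsto_of_le_of_le tendsto_const_nhds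
    (by simpa using tendsto_one_div_add_atTop_nhds_zero_nat.const_add x)
    (fun n => (hlower n).le) hupper, .of_forall hlower⟩

theorem measurable_comp_above {X : Type*} [TopologicalSpace X]
    [TopologicalSpace.PseudoMetrizableSpace X] [MeasurableSpace X] [BorelSpace X]
    {f : OneSided → X} (hf : Continuous f) : Measurable fun x => f (above x) := by
  refine measurable_of_tendsto_metrizable (fun n => ?_) (tendsto_pi_nhds.2 fun x =>
    ((hf.tendsto _).comp (OneSided.tendsto_above_nhdsGT x)).comp (tendsto_floor_mul_add_one_div x))
  exact (measurable_from_top (f := fun k : ℤ => f (above (((k : ℝ) + 1) / (n + 1))))).comp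
    (Int.measurable_floor.comp (measurable_id.mul_const _))

theorem measurable_toState (a : ℝ) {f : OneSided → ℝ × ℝ} (hf : Continuous f) :
    Measurable fun ξ => toState a (f (above (ξ / a))) :=
  (measurable_comp_above ((continuous_toState a).comp hf)).comp (measurable_id.div_const a)

/-- Convergence of profiles strong enough for convergence in `L¹` on compact sets: the profiles are
eventually uniformly bounded and converge pointwise outside a countable set of speeds. -/
structure ProfileTendsto {ι : Type*} (l : Filter ι) (f : ι → OneSided → ℝ × ℝ)
    (g : OneSided → ℝ × ℝ) : Prop where
  bounded : ∃ C, ∀ᶠ i in l, ∀ ξ, ‖f i ξ‖ ≤ C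
  tendsto : ∃ T : Set ℝ, T.Countable ∧ ∀ ξ, ξ.pos ∉ T → Tendsto (fun i => f i ξ) l (𝓝 (g ξ))

section ProfileTendsto

variable {ι : Type*} {l : Filter ι} {f f' : ι → OneSided → ℝ × ℝ} {g g' : OneSided → ℝ × ℝ}
  {P Q S : ι → ℝ × ℝ} {p q s : ℝ × ℝ}

theorem ProfileTendsto.congr' (h : ProfileTendsto l f g) (hf : f =ᶠ[l] f') :
    ProfileTendsto l f' g := by
  obtain ⟨⟨C, hC⟩, T, hT, hlim⟩ := h
  refine ⟨⟨C, ?_⟩, T, hT, fun ξ hξ => (hlim ξ hξ).congr' (hf.mono fun i hi => congrFun hi ξ)⟩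
  filter_upwards [hC, hf] with i hi hfi
  rwa [← hfi]

theorem profileTendsto_const (hP : Tendsto P l (𝓝 p)) :
    ProfileTendsto l (fun i _ => P i) fun _ => p :=
  ⟨⟨‖p‖ + 1, (hP.norm.eventually_le_const (lt_add_one _)).mono fun _ hi _ => hi⟩,
    ∅, countable_empty, fun _ _ => hP⟩

theorem ProfileTendsto.ite (h : ProfileTendsto l f g) (h' : ProfileTendsto l f' g') {c : ι → ℝ}
    {c₀ : ℝ} (hc : Tendsto c l (𝓝 c₀)) :
    ProfileTendsto l (fun i ξ => if ξ ≤ below (c i) then f i ξ else f' i ξ)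
      (fun ξ => if ξ ≤ below c₀ then g ξ else g' ξ) := by
  obtain ⟨⟨C, hC⟩, T, hT, hlim⟩ := h
  obtain ⟨⟨C', hC'⟩, T', hT', hlim'⟩ := h'
  refine ⟨⟨max C C', ?_⟩, insert c₀ (T ∪ T'), (hT.union hT').insert c₀, fun ξ hξ => ?_⟩
  · filter_upwards [hC, hC'] with i hi hi' ξ
    split_ifs
    exacts [le_max_of_le_left (hi ξ), le_max_of_le_right (hi' ξ)]
  · simp only [mem_insert_iff, mem_union, not_or] at hξ
    rcases lt_or_gt_of_ne hξ.1 with hlt | hgt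
    · rw [if_pos (OneSided.le_below_of_pos_lt hlt)]
      refine (hlim ξ hξ.2.1).congr' ?_
      filter_upwards [hc.eventually_const_lt hlt] with i hi
      rw [if_pos (OneSided.le_below_of_pos_lt hi)]
    · rw [if_neg (OneSided.not_le_below_of_lt_pos hgt)]
      refine (hlim' ξ hξ.2.2).congr' ?_
      filter_upwards [hc.eventually_lt_const hgt] with i hi
      rw [if_neg (OneSided.not_le_below_of_lt_pos hi)]

theorem norm_reflect (v : ℝ × ℝ) : ‖reflect v‖ = ‖v‖ := by simp [reflect, Prod.norm_def]

theorem ProfileTendsto.reflect (h : ProfileTendsto l f g) :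
    ProfileTendsto l (fun i ξ => reflect (f i ξ.flip)) fun ξ => reflect (g ξ.flip) := by
  obtain ⟨⟨C, hC⟩, T, hT, hlim⟩ := h
  refine ⟨⟨C, hC.mono fun i hi ξ => (norm_reflect _).trans_le (hi _)⟩, _,
    hT.preimage neg_injective, fun ξ hξ => ?_⟩
  exact (continuous_reflect.tendsto _).comp (hlim ξ.flip hξ)

theorem OnLax.dist_wave_le (h : OnLax p s) (ξ : OneSided) : dist (wave p s ξ) p ≤ dist s p := by
  refine (OneSided.forall_iff (P := fun ξ => dist (wave p s ξ) p ≤ dist s p)).2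
    (fun b => (h.forall_wave_iff b (P := fun v => dist v p ≤ dist s p)).2
      ⟨by simp, le_rfl, fun _ c hc => ?_⟩) ξ
  have hdist : dist (p.1 + p.2 - c) p.1 = dist c p.2 := by
    rw [Real.dist_eq, Real.dist_eq, ← abs_neg]
    ring_nf
  refine (max_le hdist.le le_rfl : dist (p.1 + p.2 - c, c) p ≤ dist c p.2).trans ?_
  refine le_trans ?_ (le_max_right _ _)
  exact abs_le_abs_of_nonneg (sub_nonneg.2 hc.1) (sub_le_sub_right hc.2 _)

theorem tendsto_wave_of_le (hP : Tendsto P l (𝓝 p)) (hS : Tendsto S l (𝓝 s))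
    (hPS : ∀ i, OnLax (P i) (S i)) (h : OnLax p s) (hps : s.1 ≤ p.1) (ξ : OneSided) :
    Tendsto (fun i => wave (P i) (S i) ξ) l (𝓝 (wave p s ξ)) := by
  rcases hps.lt_or_eq with hlt | heq
  · have hwave : Tendsto (fun i => ((P i).1 + (P i).2 - max (P i).2 (min (ξ.pos + 1) (S i).2),
        max (P i).2 (min (ξ.pos + 1) (S i).2))) l (𝓝 (wave p s ξ)) := by
      rw [wave_of_le hps]
      have hc := hP.snd_nhds.max ((tendsto_const_nhds (x := ξ.pos + 1)).min hS.snd_nhds)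
      exact ((hP.fst_nhds.add hP.snd_nhds).sub hc).prodMk_nhds hc
    refine hwave.congr' ?_
    filter_upwards [hS.fst_nhds.eventually_lt hP.fst_nhds hlt] with i hi
    rw [wave_of_le hi.le]
  · obtain rfl : s = p := Prod.ext heq (by rw [h, heq, sub_self, prof_zero, sub_zero])
    rw [wave_self]
    have hdist : Tendsto (fun i => dist (S i) (P i)) l (𝓝 0) := by simpa using hS.dist hP
    exact hP.congr_dist (squeeze_zero (fun _ => dist_nonneg)
      (fun i => (dist_comm _ _).trans_le ((hPS i).dist_wave_le ξ)) hdist)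

theorem profileTendsto_wave (hP : Tendsto P l (𝓝 p)) (hS : Tendsto S l (𝓝 s))
    (hPS : ∀ i, OnLax (P i) (S i)) (h : OnLax p s) :
    ProfileTendsto l (fun i => wave (P i) (S i)) (wave p s) := by
  rcases lt_or_ge p.1 s.1 with hlt | hle
  · have hspeed : Tendsto (fun i => jumpSpeed (P i) (S i).1) l (𝓝 (jumpSpeed p s.1)) :=
      hP.snd_nhds.sub ((Real.continuous_exp.tendsto _).comp
        ((hS.fst_nhds.sub hP.fst_nhds).div_const 2))
    rw [funext (wave_of_lt hlt)]
    refine ((profileTendsto_const hP).ite (profileTendsto_const hS) hspeed).congr' ?_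
    filter_upwards [hP.fst_nhds.eventually_lt hS.fst_nhds hlt] with i hi
    exact (funext (wave_of_lt hi)).symm
  · refine ⟨⟨‖p‖ + dist s p + 1, ?_⟩, ∅, countable_empty, fun ξ _ =>
      tendsto_wave_of_le hP hS hPS h hle ξ⟩
    filter_upwards [(hP.norm.add (hS.dist hP)).eventually_le_const (lt_add_one _)] with i hi ξ
    calc ‖wave (P i) (S i) ξ‖ ≤ ‖P i‖ + dist (wave (P i) (S i) ξ) (P i) := by
          rw [dist_eq_norm]; exact norm_le_norm_add_norm_sub' _ _
      _ ≤ ‖P i‖ + dist (S i) (P i) := by gcongr; exact (hPS i).dist_wave_le ξ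
      _ ≤ ‖p‖ + dist s p + 1 := hi

theorem profileTendsto_wave' (hS : Tendsto S l (𝓝 s)) (hQ : Tendsto Q l (𝓝 q))
    (hSQ : ∀ i, OnLax (reflect (Q i)) (reflect (S i))) (h : OnLax (reflect q) (reflect s)) :
    ProfileTendsto l (fun i => wave' (S i) (Q i)) (wave' s q) :=
  (profileTendsto_wave ((continuous_reflect.tendsto q).comp hQ)
    ((continuous_reflect.tendsto s).comp hS) hSQ h).reflect

theorem profileTendsto_lax (hP : Tendsto P l (𝓝 p)) (hQ : Tendsto Q l (𝓝 q)) :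
    ProfileTendsto l (fun i => lax (P i) (Q i)) (lax p q) :=
  have hm := (continuous_middle.tendsto (p, q)).comp (hP.prodMk_nhds hQ)
  (profileTendsto_wave hP hm (fun _ => onLax_middle _ _) (onLax_middle p q)).ite
    (profileTendsto_wave' hm hQ (fun _ => onLax_reflect_middle _ _) (onLax_reflect_middle p q))
    hm.snd_nhds

theorem profileTendsto_closedValve (hP : Tendsto P l (𝓝 p)) (hQ : Tendsto Q l (𝓝 q)) :
    ProfileTendsto l (fun i => closedValve (P i) (Q i)) (closedValve p q) :=
  (profileTendsto_wave hP ((continuous_wall.tendsto p).comp hP) (fun _ => onLax_wall _)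
    (onLax_wall p)).ite
    (profileTendsto_wave' (((continuous_wall.comp continuous_reflect).tendsto q).comp hQ) hQ
      (fun _ => by simpa using onLax_wall _) (by simpa using onLax_wall (reflect q)))
    tendsto_const_nhds

theorem profileTendsto_valve {K : ℝ} (hP : Tendsto P l (𝓝 p)) (hQ : Tendsto Q l (𝓝 q))
    (hK : jump p q ≠ K) : ProfileTendsto l (fun i => valve K (P i) (Q i)) (valve K p q) := by
  have hjump := (continuous_jump.tendsto (p, q)).comp (hP.prodMk_nhds hQ)
  rcases lt_or_gt_of_ne hK with h | h
  · rw [valve_of_le h.le]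
    exact (profileTendsto_closedValve hP hQ).congr'
      ((hjump.eventually_lt_const h).mono fun _ hi => (valve_of_le hi.le).symm)
  · rw [valve_of_lt h]
    exact (profileTendsto_lax hP hQ).congr'
      ((hjump.eventually_const_lt h).mono fun _ hi => (valve_of_lt hi).symm)

theorem ProfileTendsto.tendsto_lintegral [l.IsCountablyGenerated] (h : ProfileTendsto l f g)
    (h' : ProfileTendsto l f' g') (hf : ∀ i, Continuous (f i)) (hf' : ∀ i, Continuous (f' i))
    {a : ℝ} (ha : a ≠ 0) (ξ₁ ξ₂ : ℝ) :
    Tendsto (fun i => ∫⁻ ξ in Icc ξ₁ ξ₂,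
        ‖toState a (f i (above (ξ / a))) - toState a (f' i (above (ξ / a)))‖ₑ) l
      (𝓝 (∫⁻ ξ in Icc ξ₁ ξ₂,
        ‖toState a (g (above (ξ / a))) - toState a (g' (above (ξ / a)))‖ₑ)) := by
  obtain ⟨⟨C, hC⟩, T, hT, hlim⟩ := h
  obtain ⟨⟨C', hC'⟩, T', hT', hlim'⟩ := h'
  have hstate := continuous_toState a
  obtain ⟨B, hB⟩ := (isCompact_closedBall (0 : ℝ × ℝ) (max C C')).exists_bound_of_continuousOn
    hstate.continuousOn
  refine tendsto_lintegral_filter_of_dominated_convergence (fun _ => ENNReal.ofReal (B + B))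
    (.of_forall fun i => ((measurable_toState a (hf i)).sub (measurable_toState a (hf' i))).enorm)
    ?_ (by simp [ENNReal.mul_eq_top]) ?_
  · filter_upwards [hC, hC'] with i hi hi'
    refine .of_forall fun ξ => ?_
    rw [← ofReal_norm]
    refine ENNReal.ofReal_le_ofReal ((norm_sub_le _ _).trans (add_le_add (hB _ ?_) (hB _ ?_)))
    exacts [mem_closedBall_zero_iff.2 (le_max_of_le_left (hi _)),
      mem_closedBall_zero_iff.2 (le_max_of_le_right (hi' _))]
  · have hTT := ((hT.union hT').preimage (fun x y => (div_left_inj' ha).1)).ae_notMem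
      (volume.restrict (Icc ξ₁ ξ₂))
    filter_upwards [hTT] with ξ hξ
    have hξ' := not_or.1 hξ
    exact (((hstate.tendsto _).comp (hlim (above (ξ / a)) hξ'.1)).sub
      ((hstate.tendsto _).comp (hlim' (above (ξ / a)) hξ'.2))).enorm

end ProfileTendsto

theorem mem_continuityDomain {a M : ℝ} (ha : 0 < a) {p q : ℝ × ℝ} (h : jump p q ≠ M / a ^ 2) :
    (toState a p, toState a q) ∈ continuityDomain domV (RSv a M) := by
  refine ⟨mem_domV_toState a p q, fun ξ₁ ξ₂ => ?_⟩
  set d := (toState a p, toState a q) with hd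
  have hlog : ∀ r, Tendsto (toLog a) (𝓝 (toState a r)) (𝓝 r) := fun r => by
    simpa only [toLog_toState ha] using (continuousAt_toLog ha (toState_mem a r)).tendsto
  have hP : Tendsto (fun e : State × State => toLog a e.1) (𝓝[domV] d) (𝓝 p) :=
    (hlog p).comp (continuousAt_fst.tendsto.mono_left nhdsWithin_le_nhds)
  have hQ : Tendsto (fun e : State × State => toLog a e.2) (𝓝[domV] d) (𝓝 q) :=
    (hlog q).comp (continuousAt_snd.tendsto.mono_left nhdsWithin_le_nhds)
  have hconv := (profileTendsto_valve hP hQ h).tendsto_lintegral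
    (profileTendsto_valve tendsto_const_nhds tendsto_const_nhds h)
    (fun _ => continuous_valve _ _ _) (fun _ => continuous_valve _ p q) ha.ne' ξ₁ ξ₂
  simp only [sub_self, enorm_zero, lintegral_zero] at hconv
  refine hconv.congr' ?_
  filter_upwards [self_mem_nhdsWithin] with e he
  simp only [← RSv_toState ha, toState_toLog ha he.1, toState_toLog ha he.2, hd]

theorem exists_tendsto_jump_lt (p q : ℝ × ℝ) :
    ∃ P : ℝ → ℝ × ℝ, Tendsto P (𝓝[>] 0) (𝓝 p) ∧ ∀ ε > 0, jump p q < jump (P ε) q := by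
  have hlim : ∀ σ : ℝ, Tendsto (fun ε : ℝ => (p.1 + σ * ε, p.2)) (𝓝[>] 0) (𝓝 p) := fun σ =>
    ((by fun_prop : Continuous fun ε : ℝ => (p.1 + σ * ε, p.2)).tendsto' 0 p (by simp)).mono_left
      nhdsWithin_le_nhds
  have hwall : ∀ δ, (wall (p.1 + δ, p.2)).1 = (wall p).1 + δ := fun δ => add_right_comm _ _ _
  rcases le_or_gt (wall (reflect q)).1 (wall p).1 with hle | hlt
  · refine ⟨_, hlim 1, fun ε hε => ?_⟩
    have h₁ := Real.exp_le_exp.2 hle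
    have h₂ : Real.exp (wall p).1 < Real.exp ((wall p).1 + 1 * ε) :=
      Real.exp_lt_exp.2 (by linarith)
    rw [jump, jump, hwall, abs_of_nonpos (by linarith), abs_of_nonpos (by linarith)]
    linarith
  · refine ⟨_, hlim (-1), fun ε hε => ?_⟩
    have h₁ := Real.exp_lt_exp.2 hlt
    have h₂ : Real.exp ((wall p).1 + -1 * ε) < Real.exp (wall p).1 :=
      Real.exp_lt_exp.2 (by linarith)
    rw [jump, jump, hwall, abs_of_nonneg (by linarith), abs_of_nonneg (by linarith)]
    linarith

theorem frequently_nhdsGT_of_ae_restrict {P : ℝ → Prop} {x y : ℝ} (hxy : x < y)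
    (h : ∀ᵐ ξ ∂volume.restrict (Icc x y), P ξ) : ∃ᶠ ξ in 𝓝[>] x, P ξ := by
  intro hn
  obtain ⟨b, hb, hsub⟩ := (mem_nhdsGT_iff_exists_mem_Ioc_Ioo_subset hxy).1 hn
  have h' := (ae_restrict_iff' measurableSet_Ioo).1 <| ae_restrict_of_ae_restrict_of_subset
    (Ioo_subset_Icc_self.trans (Icc_subset_Icc_right hb.2)) h
  have hvol : volume (Ioo x b) ≠ 0 := by simpa using hb.1
  obtain ⟨ξ, hξ, hP⟩ := ((frequently_ae_mem_iff.2 hvol).and_eventually h').exists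
  exact hsub hξ (hP hξ)

theorem eq_of_lintegral_eq_zero {a : ℝ} (ha : 0 < a) {f g : OneSided → ℝ × ℝ} (hf : Continuous f)
    (hg : Continuous g) {x y : ℝ} (hxy : x < y)
    (h : ∫⁻ ξ in Icc x y, ‖toState a (f (above (ξ / a))) - toState a (g (above (ξ / a)))‖ₑ = 0) :
    f (above (x / a)) = g (above (x / a)) := by
  have hmeas : Measurable fun ξ =>
      ‖toState a (f (above (ξ / a))) - toState a (g (above (ξ / a)))‖ₑ :=
    ((measurable_toState a hf).sub (measurable_toState a hg)).enorm
  have hae : ∀ᵐ ξ ∂volume.restrict (Icc x y),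
      toState a (f (above (ξ / a))) = toState a (g (above (ξ / a))) :=
    ((lintegral_eq_zero_iff hmeas).1 h).mono fun ξ hξ => sub_eq_zero.1 (enorm_eq_zero.1 hξ)
  exact toState_injective ha <| tendsto_nhds_unique_of_frequently_eq
    (tendsto_toState_nhdsGT ha hf x) (tendsto_toState_nhdsGT ha hg x)
    (frequently_nhdsGT_of_ae_restrict hxy hae)

theorem notMem_continuityDomain {a M : ℝ} (ha : 0 < a) (hM : 0 < M) {p q : ℝ × ℝ}
    (h : jump p q = M / a ^ 2) :
    (toState a p, toState a q) ∉ continuityDomain domV (RSv a M) := by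
  rintro ⟨-, hcont⟩
  obtain ⟨P, hP, hjump⟩ := exists_tendsto_jump_lt p q
  have hdata : Tendsto (fun ε => (toState a (P ε), toState a q)) (𝓝[>] 0)
      (𝓝[domV] (toState a p, toState a q)) :=
    tendsto_nhdsWithin_iff.2 ⟨(((continuous_toState a).tendsto p).comp hP).prodMk_nhds
      tendsto_const_nhds, .of_forall fun ε => mem_domV_toState a (P ε) q⟩
  have hlim := (profileTendsto_lax hP (tendsto_const_nhds (x := q))).tendsto_lintegral
    (profileTendsto_closedValve (tendsto_const_nhds (x := p)) (tendsto_const_nhds (x := q)))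
    (fun _ => continuous_lax _ _) (fun _ => continuous_closedValve p q) ha.ne' 0 1
  have hzero := tendsto_nhds_unique hlim <| ((hcont 0 1).comp hdata).congr' <| by
    filter_upwards [self_mem_nhdsWithin] with ε hε
    simp only [Function.comp_apply, RSv_toState ha, valve_of_lt (h ▸ hjump ε hε),
      valve_of_le h.le]
  have hagree := eq_of_lintegral_eq_zero ha (continuous_lax p q) (continuous_closedValve p q)
    one_pos hzero
  have hmiddle : (middle p q).2 = 0 := (lax_snd_eq_zero_iff (ξ := above (0 / a)) (by simp)).1 <| by
    rw [hagree, closedValve_snd (by simp)]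
  have hpos : 0 < M / a ^ 2 := by positivity
  exact hpos.ne (jump_eq_zero_of_middle hmiddle ▸ h)

theorem continuityDomain_RSv {a M : ℝ} (ha : 0 < a) (hM : 0 < M) :
    continuityDomain domV (RSv a M) = {d ∈ domV | closedJump a d.1 d.2 ≠ M} := by
  refine eq_of_forall_toState_mem_iff ha (fun d hd => hd.1) (fun d hd => hd.1) fun p q => ?_
  have hjump : closedJump a (toState a p) (toState a q) = M ↔ jump p q = M / a ^ 2 := by
    rw [closedJump_toState ha, eq_div_iff (by positivity), mul_comm]
  simp only [mem_ofPred_eq, mem_domV_toState, true_and, ne_eq, hjump]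
  exact ⟨fun h h' => notMem_continuityDomain ha hM h' h, mem_continuityDomain ha⟩

end

end GasValve

theorem theorem1 (a M : ℝ) (ha : 0 < a) (hM : 0 < M) :
    -- (I) coherence domain
    GasValve.coherenceDomain GasValve.domV (GasValve.RSv a M) =
      GasValve.setA a M ∪ GasValve.setOO a M ∧
    -- (II) consistence domain
    (GasValve.consistenceDomain GasValve.domV (GasValve.RSv a M) =
        GasValve.setCN1 a M ∪ GasValve.setCN2 a M ∧
      GasValve.consistenceDomain GasValve.domV (GasValve.RSv a M) =
        GasValve.setCNO a M ∪ GasValve.setCNA a M) ∧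
    -- (III) continuity domain
    GasValve.continuityDomain GasValve.domV (GasValve.RSv a M) =
      {d ∈ GasValve.domV | GasValve.closedJump a d.1 d.2 ≠ M} ∧
    -- (IV) invariant domains
    (∀ u₀ ∈ GasValve.Omega, u₀.2 = 0 →
      GasValve.IsInvariantDomain GasValve.domV (GasValve.RSv a M) (GasValve.invRegion a u₀)) := by
  exact ⟨GasValve.coherenceDomain_RSv ha M,
    ⟨GasValve.consistenceDomain_RSv_eq_CN1_union_CN2 ha M,
      GasValve.consistenceDomain_RSv_eq_CNO_union_CNA ha hM⟩,
    GasValve.continuityDomain_RSv ha hM,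
    fun _ _ h₀ => GasValve.isInvariantDomain_invRegion ha M h₀⟩
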